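/- Let $(X,\Sigma,\mu)$ be a probability space, $L^1=L^1(X,\Sigma,\mu;\mathbb C)$, $L^\infty=L^\infty(X,\Sigma,\mu;\mathbb C)\subseteq L^1$, and let $\Sigma(X)$ be the measure algebra, i.e. $\Sigma$ modulo equality up to $\mu$-null sets. Let $(T(t))_{t\ge 0}$ be a $C_0$-semigroup of bounded linear operators on $L^1$ with generator $(A,D(A))$. Then the following are equivalent. (i) $(T(t))_{t\ge0}$ is a semigroup of Markov lattice operators, i.e. for every $t\ge 0$ the operator $T(t)$ is positive and satisfies $|T(t)f|=T(t)|f|$ and $\int_X T(t)f\,d\mu=\int_X f\,d\mu$ for all $f\in L^1$, and $T(t)\mathbb 1=\mathbb 1$. (ii) For each $t\ge 0$ there is a measure algebra homomorphism $\varphi_t^*\colon\Sigma(X)\to\Sigma(X)$, i.e. a map preserving finite unions and intersections (hence the order) and the measure $\mu$, such that $T(t)\mathbb 1_M=\mathbb 1_{\varphi_t^*(M)}$ for all $M\in\Sigma(X)$. (iii) $T(t)L^\infty\subseteq L^\infty$ for all $t\ge0$; $D(A)\cap L^\infty$ is an algebra under pointwise multiplication and is dense in $L^1$; $A$ is a derivation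 on this algebra, i.e. $D(A)\cap L^\infty$ is invariant under complex conjugation and contains $\mathbb 1$, and $A(fg)=(Af)g+f(Ag)$ and $A\overline f=\overline{Af}$ in $L^1$ for all $f,g\in D(A)\cap L^\infty$; and $A'\mu=0$, i.e. $\int_X Af\,d\mu=0$ for all $f\in D(A)$. -/

import Mathlib

open MeasureTheory Filter Topology
open scoped NNReal ENNReal

noncomputable section

/-- A `C₀`-semigroup of bounded linear operators on a complex normed space. -/
structure C0Semigroup (E : Type*) [NormedAddCommGroup E] [NormedSpace ℂ E] where
  op : ℝ≥0 → E →L[ℂ] E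
  op_zero : op 0 = ContinuousLinearMap.id ℂ E
  op_add : ∀ s t : ℝ≥0, op (s + t) = (op s).comp (op t)
  tendsto_zero : ∀ f : E, Tendsto (fun t => op t f) (𝓝 0) (𝓝 f)

namespace C0Semigroup

variable {E : Type*} [NormedAddCommGroup E] [NormedSpace ℂ E]

/-- The difference quotient `(T(t) f - f) / t` converges to `g` as `t ↓ 0`. -/
def HasGenerator (T : C0Semigroup E) (f g : E) : Prop :=
  Tendsto (fun t : ℝ≥0 => (((t : ℝ) : ℂ)⁻¹) • (T.op t f - f)) (𝓝[>] 0) (𝓝 g)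

theorem HasGenerator.unique {T : C0Semigroup E} {f g h : E} (hg : T.HasGenerator f g)
    (hh : T.HasGenerator f h) : g = h :=
  tendsto_nhds_unique hg hh

theorem HasGenerator.add {T : C0Semigroup E} {f₁ f₂ g₁ g₂ : E} (h₁ : T.HasGenerator f₁ g₁)
    (h₂ : T.HasGenerator f₂ g₂) : T.HasGenerator (f₁ + f₂) (g₁ + g₂) := by
  refine (Tendsto.add h₁ h₂).congr fun t => ?_
  rw [map_add, ← smul_add]
  congr 1
  abel

theorem HasGenerator.smul {T : C0Semigroup E} {f g : E} (c : ℂ) (h : T.HasGenerator f g) :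
    T.HasGenerator (c • f) (c • g) := by
  refine (Tendsto.const_smul h c).congr fun t => ?_
  rw [map_smul, ← smul_sub, smul_comm]

/-- The generator `(A, D(A))`: `D(A)` consists of the `f` for which `(T(t) f - f) / t` converges
as `t ↓ 0`, and `A f` is the limit. -/
def generator (T : C0Semigroup E) : E →ₗ.[ℂ] E where
  domain :=
    { carrier := {f | ∃ g, T.HasGenerator f g}
      zero_mem' := ⟨0, by simp [HasGenerator]⟩
      add_mem' := fun ⟨_, h₁⟩ ⟨_, h₂⟩ => ⟨_, h₁.add h₂⟩
      smul_mem' := fun c _ ⟨_, h⟩ => ⟨_, h.smul c⟩ }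
  toFun :=
    { toFun := fun f => f.2.choose
      map_add' := fun f g =>
        (f + g).2.choose_spec.unique (f.2.choose_spec.add g.2.choose_spec)
      map_smul' := fun c f => (c • f).2.choose_spec.unique (f.2.choose_spec.smul c) }

theorem hasGenerator_generator (T : C0Semigroup E) (f : T.generator.domain) :
    T.HasGenerator f (T.generator f) :=
  f.2.choose_spec

end C0Semigroup

variable {X : Type*} [MeasurableSpace X]

/-- Measurable sets are identified when they agree up to a null set. -/
def measurableSetSetoid (μ : Measure X) : Setoid {s : Set X // MeasurableSet s} where
  r s t := (s : Set X) =ᵐ[μ] (t : Set X)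
  iseqv := ⟨fun _ => EventuallyEq.rfl, fun h => h.symm, fun h₁ h₂ => h₁.trans h₂⟩

/-- The measure algebra `Σ(X) = Σ / ∼`. -/
def MeasureAlg (μ : Measure X) : Type _ := Quotient (measurableSetSetoid μ)

namespace MeasureAlg

variable {μ : Measure X}

/-- The class `[M]` of a measurable set `M`. -/
def mk (μ : Measure X) (s : Set X) (hs : MeasurableSet s) : MeasureAlg μ :=
  Quotient.mk (measurableSetSetoid μ) ⟨s, hs⟩

theorem ind {p : MeasureAlg μ → Prop} (h : ∀ s hs, p (mk μ s hs)) (a : MeasureAlg μ) : p a :=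
  Quotient.ind (fun s => h s.1 s.2) a

/-- The order of the measure algebra is inclusion up to null sets; binary suprema and infima are
the classes of unions and intersections. -/
instance : Lattice (MeasureAlg μ) where
  le := Quotient.lift₂ (fun s t => (s : Set X) ≤ᵐ[μ] (t : Set X)) (by
    intro a b c d (h₁ : (a : Set X) =ᵐ[μ] (c : Set X)) (h₂ : (b : Set X) =ᵐ[μ] (d : Set X))
    exact propext ⟨fun h => h₁.symm.le.trans (h.trans h₂.le),
      fun h => h₁.le.trans (h.trans h₂.symm.le)⟩)
  le_refl := Quotient.ind fun s => EventuallyLE.rfl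
  le_trans := by
    intro a b c
    induction a, b, c using Quotient.inductionOn₃
    exact fun h₁ h₂ => EventuallyLE.trans h₁ h₂
  le_antisymm := by
    intro a b
    induction a, b using Quotient.inductionOn₂
    exact fun h₁ h₂ => Quotient.sound (EventuallyLE.antisymm h₁ h₂)
  sup := Quotient.map₂ (fun s t => ⟨(s : Set X) ∪ (t : Set X), s.2.union t.2⟩)
    (fun _ _ h₁ _ _ h₂ => EventuallyEq.union h₁ h₂)
  inf := Quotient.map₂ (fun s t => ⟨(s : Set X) ∩ (t : Set X), s.2.inter t.2⟩)
    (fun _ _ h₁ _ _ h₂ => EventuallyEq.inter h₁ h₂)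
  le_sup_left := by
    intro a b
    induction a, b using Quotient.inductionOn₂
    exact Eventually.of_forall fun _ hx => Set.subset_union_left hx
  le_sup_right := by
    intro a b
    induction a, b using Quotient.inductionOn₂
    exact Eventually.of_forall fun _ hx => Set.subset_union_right hx
  sup_le := by
    intro a b c
    induction a, b, c using Quotient.inductionOn₃
    intro h₁ h₂
    filter_upwards [h₁, h₂] with x hx₁ hx₂ hx
    exact hx.elim hx₁ hx₂
  inf_le_left := by
    intro a b
    induction a, b using Quotient.inductionOn₂
    exact Eventually.of_forall fun _ hx => Set.inter_subset_left hx
  inf_le_right := by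
    intro a b
    induction a, b using Quotient.inductionOn₂
    exact Eventually.of_forall fun _ hx => Set.inter_subset_right hx
  le_inf := by
    intro a b c
    induction a, b, c using Quotient.inductionOn₃
    intro h₁ h₂
    filter_upwards [h₁, h₂] with x hx₁ hx₂ hx
    exact ⟨hx₁ hx, hx₂ hx⟩

theorem mk_le_mk {s t : Set X} (hs : MeasurableSet s) (ht : MeasurableSet t) :
    mk μ s hs ≤ mk μ t ht ↔ s ≤ᵐ[μ] t :=
  Iff.rfl

theorem mk_sup_mk {s t : Set X} (hs : MeasurableSet s) (ht : MeasurableSet t) :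
    mk μ s hs ⊔ mk μ t ht = mk μ (s ∪ t) (hs.union ht) :=
  rfl

theorem mk_inf_mk {s t : Set X} (hs : MeasurableSet s) (ht : MeasurableSet t) :
    mk μ s hs ⊓ mk μ t ht = mk μ (s ∩ t) (hs.inter ht) :=
  rfl

/-- The measure, as a function on the measure algebra. -/
def measure : MeasureAlg μ → ℝ≥0∞ :=
  Quotient.lift (fun s => μ s.1) fun _ _ h => measure_congr h

/-- The class `𝟙_M` in `L¹` of the indicator function of an element `M` of the measure algebra. -/
def indicator [IsProbabilityMeasure μ] : MeasureAlg μ → Lp ℂ 1 μ :=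
  Quotient.lift (fun s => indicatorConstLp 1 s.2 (measure_ne_top μ s.1) (1 : ℂ))
    fun _ _ h => MemLp.toLp_congr _ _ (indicator_ae_eq_of_ae_eq_set h)

end MeasureAlg

/-- A measure algebra homomorphism of `Σ(X)`: a map respecting the lattice structure
(finite unions and intersections, hence the order) and the measure. -/
structure MeasureAlgHom (μ : Measure X) extends LatticeHom (MeasureAlg μ) (MeasureAlg μ) where
  measure_map : ∀ M : MeasureAlg μ, (toFun M).measure = M.measure

/-- `L^∞` as a subspace of `L¹`. -/
def LInfty (μ : Measure X) : Submodule ℂ (Lp ℂ 1 μ) where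
  carrier := {f | MemLp f ∞ μ}
  zero_mem' := (memLp_congr_ae (Lp.coeFn_zero ℂ 1 μ)).2 MemLp.zero
  add_mem' := fun {f g} hf hg => (memLp_congr_ae (Lp.coeFn_add f g)).2 (MemLp.add hf hg)
  smul_mem' := fun c f hf => (memLp_congr_ae (Lp.coeFn_smul c f)).2 (MemLp.const_smul hf c)

/-- The pointwise product `f · g ∈ L¹` of `f ∈ L^∞` and `g ∈ L¹`. -/
def bmul {μ : Measure X} (f : LInfty μ) (g : Lp ℂ 1 μ) : Lp ℂ 1 μ :=
  MemLp.toLp (fun x => (f : Lp ℂ 1 μ) x * g x) ((Lp.memLp g).mul f.2)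

/-- The pointwise modulus `|f| ∈ L¹` of `f ∈ L¹`. -/
def modulus {μ : Measure X} (f : Lp ℂ 1 μ) : Lp ℂ 1 μ :=
  MemLp.toLp (fun x => ((‖f x‖ : ℝ) : ℂ)) (Lp.memLp f).norm.ofReal

/-- The constant function `𝟙` in `L¹`. -/
def oneL (μ : Measure X) [IsProbabilityMeasure μ] : Lp ℂ 1 μ := Lp.const 1 μ (1 : ℂ)

open scoped ComplexOrder in
/-- `T` is a positive operator on `L¹`. -/
def IsPositiveOp {μ : Measure X} (T : Lp ℂ 1 μ →L[ℂ] Lp ℂ 1 μ) : Prop :=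
  ∀ f : Lp ℂ 1 μ, (∀ᵐ x ∂μ, 0 ≤ f x) → ∀ᵐ x ∂μ, 0 ≤ T f x

/-- A Markov lattice operator on `L¹`: a positive operator with `|T f| = T |f|`, `T 𝟙 = 𝟙` and
`∫ T f dμ = ∫ f dμ`. -/
structure IsMarkovLatticeOp {μ : Measure X} [IsProbabilityMeasure μ]
    (T : Lp ℂ 1 μ →L[ℂ] Lp ℂ 1 μ) : Prop where
  positive : IsPositiveOp T
  map_modulus : ∀ f : Lp ℂ 1 μ, modulus (T f) = T (modulus f)
  map_one : T (oneL μ) = oneL μ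
  integral_map : ∀ f : Lp ℂ 1 μ, ∫ x, T f x ∂μ = ∫ x, f x ∂μ

/-- `D(A) ∩ L^∞`. -/
def boundedDomain {μ : Measure X} (A : Lp ℂ 1 μ →ₗ.[ℂ] Lp ℂ 1 μ) : Submodule ℂ (Lp ℂ 1 μ) :=
  A.domain ⊓ LInfty μ

/-- The linear subspace `D` of `L¹` is an algebra of bounded functions for pointwise
multiplication. -/
def IsBoundedAlgebra {μ : Measure X} (D : Submodule ℂ (Lp ℂ 1 μ)) : Prop :=
  ∃ hD : D ≤ LInfty μ, ∀ f g : D, bmul ⟨f, hD f.2⟩ g ∈ D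

/-- The (possibly unbounded) operator `A` on `L¹` restricts to a derivation on `D(A) ∩ L^∞`, which
is a conjugation invariant algebra containing `𝟙`. The values of `A` are in `L¹`. -/
structure IsDerivationOnBounded {μ : Measure X} [IsProbabilityMeasure μ]
    (A : Lp ℂ 1 μ →ₗ.[ℂ] Lp ℂ 1 μ) : Prop where
  isAlgebra : IsBoundedAlgebra (boundedDomain A)
  one_mem : oneL μ ∈ boundedDomain A
  leibniz : ∀ (f g : Lp ℂ 1 μ) (hf : f ∈ boundedDomain A) (hg : g ∈ boundedDomain A),
    ∃ h : bmul ⟨f, hf.2⟩ g ∈ A.domain,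
      A ⟨bmul ⟨f, hf.2⟩ g, h⟩ = bmul ⟨g, hg.2⟩ (A ⟨f, hf.1⟩) + bmul ⟨f, hf.2⟩ (A ⟨g, hg.1⟩)
  map_star : ∀ (f : Lp ℂ 1 μ) (hf : f ∈ boundedDomain A),
    ∃ h : star f ∈ A.domain, A ⟨star f, h⟩ = star (A ⟨f, hf.1⟩)

/-- `A'μ = 0`, where `μ` is the functional `f ↦ ∫ f dμ` on `L¹`. -/
def AdjointAnnihilates {μ : Measure X} (A : Lp ℂ 1 μ →ₗ.[ℂ] Lp ℂ 1 μ) : Prop :=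
  ∀ f : A.domain, ∫ x, A f x ∂μ = 0

end

/-! Between (i) and (ii). The identity |2·1_M - 1| = 1 forces |2·T1_M - 1| = 1 for a lattice
operator fixing 1. Since T1_M is real, its values are 0 and 1, so it is an indicator; intersections
are respected because 2·1_{M∩N} = 1_M + 1_N - |1_M - 1_N|. Conversely, an operator induced by a
measure algebra homomorphism commutes with every pointwise function of a simple function
(`IsKoopman.map_simple`). By density it commutes with modulus and conjugation, and it is
multiplicative and an L^∞-contraction.

From (ii) to (iii). Differentiating T(t)(fg) = T(t)f · T(t)g at t = 0 gives the Leibniz rule.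
Density of D(A) ∩ L^∞ follows from averaging orbits, which stay in an L^∞-ball.

From (iii) to (ii), the main point. For f, g in D(A) ∩ L^∞ the curve t ↦ T(t)f · T(t)g solves u' =
Au with initial value fg, so it equals T(t)(fg) by uniqueness (`eq_op_of_hasRightDeriv`). A
multiplicative operator maps idempotents to idempotents, hence indicators to indicators. The
difficulty is that the product of L¹-differentiable curves is differentiable in L¹ only under local
L^∞ bounds, while (iii) merely says that each T(t) leaves L^∞ invariant. Closed graph and Baire give
such bounds at positive times (`eventually_bddBy_op`). There the moments ∫|T(t)f|^{2n} have
derivative ∫A(·) = 0, so the L^∞-norm is constant for t > 0, which carries the bound down to t = 0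
(`boundedSolution_orbit`). -/

namespace C0Semigroup

/-! ### C₀-semigroups: local bounds, the Cauchy problem, averages of orbits. -/

variable {E : Type*} [NormedAddCommGroup E] [NormedSpace ℂ E]

theorem op_add_apply (T : C0Semigroup E) (s t : ℝ≥0) (f : E) :
    T.op (s + t) f = T.op s (T.op t f) := by
  rw [T.op_add]; rfl

theorem op_zero_apply (T : C0Semigroup E) (f : E) : T.op 0 f = f := by
  rw [T.op_zero]; rfl

/-- Otherwise there are times tending to 0 with unbounded operator norms, although every orbit
converges along them; this contradicts uniform boundedness. -/
theorem exists_norm_op_le_near_zero [CompleteSpace E] (T : C0Semigroup E) :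
    ∃ δ : ℝ≥0, 0 < δ ∧ ∃ M : ℝ, ∀ s ≤ δ, ‖T.op s‖ ≤ M := by
  by_contra! H
  have hpos : ∀ n : ℕ, (0 : ℝ≥0) < 1 / ((n : ℝ≥0) + 1) := fun n => by positivity
  choose s hs hsn using fun n : ℕ => H _ (hpos n) n
  have hs0 : Tendsto s atTop (𝓝 0) :=
    tendsto_of_tendsto_of_tendsto_of_le_of_le tendsto_const_nhds
      tendsto_one_div_add_atTop_nhds_zero_nat (fun _ => zero_le) hs
  obtain ⟨C, hC⟩ := banach_steinhaus (g := fun n => T.op (s n)) fun f => by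
    obtain ⟨C, hC⟩ := ((T.tendsto_zero f).comp hs0).norm.bddAbove_range
    exact ⟨C, fun n => hC ⟨n, rfl⟩⟩
  obtain ⟨n, hn⟩ := exists_nat_gt C
  exact absurd (hC n) (not_le.2 (hn.trans (hsn n)))

theorem exists_norm_op_le [CompleteSpace E] (T : C0Semigroup E) (t : ℝ≥0) :
    ∃ M : ℝ, ∀ s ≤ t, ‖T.op s‖ ≤ M := by
  obtain ⟨δ, hδ, M, hM⟩ := T.exists_norm_op_le_near_zero
  -- The interval is covered in steps of length δ; `max M 1` makes the powers increase with the
  -- number of steps.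
  have key : ∀ n : ℕ, ∀ s ≤ (n + 1 : ℝ≥0) * δ, ‖T.op s‖ ≤ (max M 1) ^ (n + 1) := by
    intro n
    induction n with
    | zero =>
      intro s hs
      simpa using Or.inl (hM s (by simpa using hs))
    | succ n ih =>
      intro s hs
      rcases le_total s δ with h | h
      · exact (hM s h).trans ((le_max_left M 1).trans
          (le_self_pow₀ (le_max_right M 1) (by omega)))
      · have : s = δ + (s - δ) := (add_tsub_cancel_of_le h).symm
        rw [this, T.op_add, pow_succ']
        refine (ContinuousLinearMap.opNorm_comp_le _ _).trans ?_
        refine mul_le_mul ((hM δ le_rfl).trans (le_max_left _ _)) (ih _ ?_) (norm_nonneg _)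
          (zero_le_one.trans (le_max_right _ _))
        rw [tsub_le_iff_left]
        refine hs.trans (le_of_eq ?_)
        push_cast
        ring
  obtain ⟨n, hn⟩ := exists_nat_gt (t / δ)
  refine ⟨_, fun s hs => key n s (hs.trans ?_)⟩
  rw [← div_le_iff₀ hδ]
  exact hn.le.trans (by simp)

theorem continuous_orbit [CompleteSpace E] (T : C0Semigroup E) (f : E) :
    Continuous fun t => T.op t f := by
  rw [continuous_iff_continuousAt]
  intro t
  obtain ⟨M, hM⟩ := T.exists_norm_op_le (t + 1)
  have hM0 : 0 ≤ M := (norm_nonneg _).trans (hM 0 zero_le)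
  have hd : Tendsto (fun s => nndist s t) (𝓝 t) (𝓝 0) := by
    have : Continuous fun s : ℝ≥0 => nndist s t := by fun_prop
    simpa using this.tendsto t
  have h1 : Tendsto (fun s => M * ‖T.op (nndist s t) f - f‖) (𝓝 t) (𝓝 0) := by
    have := (((T.tendsto_zero f).comp hd).sub_const f).norm.const_mul M
    simpa using this
  refine tendsto_iff_norm_sub_tendsto_zero.2 (squeeze_zero' (Eventually.of_forall fun _ =>
    norm_nonneg _) ?_ h1)
  filter_upwards [Iio_mem_nhds (show t < t + 1 by simp)] with s hs
  -- Both one-sided limits reduce to strong continuity at 0 by factoring out the operator at the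
  -- smaller time, whose norm is at most M.
  have aux : ∀ a b : ℝ≥0, a ≤ b → a ≤ t + 1 → nndist a b = nndist s t →
      ‖T.op b f - T.op a f‖ ≤ M * ‖T.op (nndist s t) f - f‖ := by
    intro a b hab ha hdist
    have hb : b = a + nndist s t := by
      rw [← hdist]
      apply NNReal.coe_injective
      have : (a : ℝ) ≤ b := hab
      rw [NNReal.coe_add, coe_nndist, NNReal.dist_eq, abs_sub_comm, abs_of_nonneg (by linarith)]
      ring
    rw [hb, T.op_add_apply, ← map_sub]
    exact (T.op a).le_of_opNorm_le (hM a ha) _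
  rcases le_total s t with h | h
  · rw [norm_sub_rev]
    exact aux s t h hs.le rfl
  · exact aux t s h (by simp) (nndist_comm _ _)

theorem tendsto_op [CompleteSpace E] (T : C0Semigroup E) {ι : Type*} {l : Filter ι} {a : ι → ℝ≥0}
    {b : ι → E} {t : ℝ≥0} {f : E} (ha : Tendsto a l (𝓝 t)) (hb : Tendsto b l (𝓝 f)) :
    Tendsto (fun i => T.op (a i) (b i)) l (𝓝 (T.op t f)) := by
  obtain ⟨M, hM⟩ := T.exists_norm_op_le (t + 1)
  have h1 : Tendsto (fun i => T.op (a i) (b i - f)) l (𝓝 0) := by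
    have : Tendsto (fun i => M * ‖b i - f‖) l (𝓝 0) := by
      simpa using ((hb.sub_const f).norm.const_mul M)
    refine squeeze_zero_norm' ?_ this
    filter_upwards [ha.eventually (Iio_mem_nhds (show t < t + 1 by simp))] with i hi
    exact (T.op (a i)).le_of_opNorm_le (hM _ hi.le) _
  have h2 := h1.add (((T.continuous_orbit f).tendsto t).comp ha)
  simpa using h2

/-- The curve `F` has right derivative `v` at `r`. -/
def HasRightDeriv (F : ℝ≥0 → E) (v : E) (r : ℝ≥0) : Prop :=
  Tendsto (fun h : ℝ≥0 => (((h : ℝ) : ℂ)⁻¹) • (F (r + h) - F r)) (𝓝[>] 0) (𝓝 v)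

theorem hasGenerator_iff {T : C0Semigroup E} {f g : E} :
    T.HasGenerator f g ↔ HasRightDeriv (fun t => T.op t f) g 0 := by
  simp only [HasGenerator, HasRightDeriv, zero_add, T.op_zero_apply]

theorem HasGenerator.hasRightDeriv {T : C0Semigroup E} {f g : E} (h : T.HasGenerator f g)
    (r : ℝ≥0) : HasRightDeriv (fun t => T.op t f) (T.op r g) r := by
  refine (((T.op r).continuous.tendsto g).comp h).congr fun t => ?_
  simp [T.op_add_apply, map_sub]

theorem HasGenerator.op {T : C0Semigroup E} {f g : E} (h : T.HasGenerator f g)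
    (r : ℝ≥0) : T.HasGenerator (T.op r f) (T.op r g) := by
  refine (h.hasRightDeriv r).congr fun t => ?_
  simp only [add_comm r t, T.op_add_apply]

theorem tendsto_nhdsGT_zero_add (r : ℝ≥0) : Tendsto (fun h => r + h) (𝓝[>] 0) (𝓝 r) := by
  have : Tendsto (fun h => r + h) (𝓝 0) (𝓝 (r + 0)) := by
    apply Continuous.tendsto
    fun_prop
  rw [add_zero] at this
  exact this.mono_left nhdsWithin_le_nhds

/-- For a continuous curve a vanishing right derivative already forces constancy, so two-sided
derivatives of orbits are never needed. -/
theorem eq_of_hasRightDeriv_zero {F : ℝ≥0 → E} {a b : ℝ≥0} (hab : a ≤ b)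
    (hF : ∀ r, a ≤ r → r ≤ b → ContinuousAt F r)
    (hd : ∀ r, a ≤ r → r < b → HasRightDeriv F 0 r) : F b = F a := by
  have hcont : ContinuousOn (fun x : ℝ => F x.toNNReal) (Set.Icc a b) := by
    intro x hx
    refine ContinuousAt.continuousWithinAt ?_
    refine ContinuousAt.comp (f := Real.toNNReal) (hF _ ?_ ?_) continuous_real_toNNReal.continuousAt
    · exact NNReal.le_toNNReal_of_coe_le hx.1
    · exact Real.toNNReal_le_iff_le_coe.2 hx.2
  have := constant_of_has_deriv_right_zero hcont (fun x hx => ?_) b ⟨hab, le_rfl⟩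
  · simpa using this
  · lift x to ℝ≥0 using a.2.trans hx.1
    have hx' := hd x (by exact_mod_cast hx.1) (by exact_mod_cast hx.2)
    rw [hasDerivWithinAt_iff_tendsto_slope]
    have hsub : Tendsto (fun y : ℝ => (y - x).toNNReal) (𝓝[Set.Ici (x : ℝ) \ {(x : ℝ)}] x)
        (𝓝[>] 0) := by
      refine tendsto_nhdsWithin_iff.2 ⟨?_, ?_⟩
      · have : Continuous fun y : ℝ => (y - x).toNNReal := by fun_prop
        have h0 := this.tendsto x
        rw [sub_self, Real.toNNReal_zero] at h0
        exact h0.mono_left nhdsWithin_le_nhds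
      · filter_upwards [self_mem_nhdsWithin] with y hy
        have : (x : ℝ) < y := lt_of_le_of_ne hy.1 (fun h => hy.2 h.symm)
        simpa using this
    refine (hx'.comp hsub).congr' ?_
    filter_upwards [self_mem_nhdsWithin] with y hy
    have h1 : (x : ℝ) ≤ y := hy.1
    have h2 : x + (y - x).toNNReal = y.toNNReal := by
      apply NNReal.coe_injective
      rw [NNReal.coe_add, Real.coe_toNNReal _ (sub_nonneg.2 h1),
        Real.coe_toNNReal _ (x.2.trans h1)]
      ring
    simp only [Function.comp, slope, vsub_eq_sub, Real.toNNReal_coe]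
    rw [h2, Real.coe_toNNReal _ (sub_nonneg.2 h1), ← Complex.ofReal_inv]
    rfl

/-- Uniqueness of solutions of the abstract Cauchy problem `F' = A F`. -/
theorem eq_op_of_hasRightDeriv [CompleteSpace E] (T : C0Semigroup E) {F : ℝ≥0 → E}
    (hF : Continuous F) (hd : ∀ r, ∃ g, T.HasGenerator (F r) g ∧ HasRightDeriv F g r)
    (t : ℝ≥0) : F t = T.op t (F 0) := by
  -- The curve r ↦ T(t-r)F(r) joins T(t)F(0) to F(t). Its difference quotient is T(t-r-h) applied to
  -- the difference of the quotients of F and of h ↦ T(h)F(r), both of which tend to A F(r).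
  have key := eq_of_hasRightDeriv_zero (F := fun r => T.op (t - r) (F r)) (zero_le (a := t))
    (fun r _ _ => ?_) (fun r _ hr => ?_)
  · simpa [T.op_zero_apply] using key
  · exact T.tendsto_op (Continuous.tendsto (by fun_prop) r) (hF.tendsto r)
  · obtain ⟨g, hg, hFg⟩ := hd r
    have hsub : Tendsto (fun h => t - (r + h)) (𝓝[>] 0) (𝓝 (t - r)) := by
      have : Continuous fun s => t - s := by fun_prop
      exact (this.tendsto r).comp (tendsto_nhdsGT_zero_add r)
    have h1 := T.tendsto_op hsub hFg
    have h2 := T.tendsto_op hsub hg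
    have h3 := h1.sub h2
    rw [sub_self] at h3
    refine h3.congr' ?_
    have hev : ∀ᶠ h in 𝓝[>] (0 : ℝ≥0), r + h < t :=
      (tendsto_nhdsGT_zero_add r).eventually (Iio_mem_nhds hr)
    filter_upwards [hev] with h hh
    have h4 : t - r = (t - (r + h)) + h := by
      rw [tsub_add_eq_tsub_tsub, tsub_add_cancel_of_le]
      exact le_tsub_of_add_le_left hh.le
    rw [← map_sub, ← smul_sub, map_smul, h4, T.op_add_apply, ← map_sub]
    congr 2
    abel

theorem HasGenerator.mem_domain {T : C0Semigroup E} {f g : E} (h : T.HasGenerator f g) :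
    f ∈ T.generator.domain :=
  ⟨g, h⟩

theorem generator_eq {T : C0Semigroup E} {f g : E} (h : T.HasGenerator f g)
    (hf : f ∈ T.generator.domain) : T.generator ⟨f, hf⟩ = g :=
  (T.hasGenerator_generator ⟨f, hf⟩).unique h

open intervalIntegral in
/-- The integrals `∫₀ᵗ T(s) f ds` belong to the domain of the generator. -/
theorem integral_orbit_mem_domain [CompleteSpace E] (T : C0Semigroup E) (f : E) (t : ℝ≥0) :
    ∫ s in (0 : ℝ)..t, T.op s.toNNReal f ∈ T.generator.domain := by
  have hc : Continuous fun s : ℝ => T.op s.toNNReal f :=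
    (T.continuous_orbit f).comp continuous_real_toNNReal
  have hi : ∀ a b : ℝ, IntervalIntegrable (fun s : ℝ => T.op s.toNNReal f) volume a b :=
    fun a b => hc.intervalIntegrable a b
  refine ⟨T.op t f - f, ?_⟩
  have hder : ∀ a : ℝ≥0, Tendsto (fun h : ℝ≥0 => (((h : ℝ) : ℂ)⁻¹) •
      ∫ s in (a : ℝ)..(a + h), T.op s.toNNReal f) (𝓝[>] 0) (𝓝 (T.op a f)) := by
    intro a
    have h1 : HasDerivAt (fun u : ℝ => ∫ s in (a : ℝ)..u, T.op s.toNNReal f)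
        (T.op a f) (a : ℝ) := by
      have := integral_hasDerivAt_right (hi a a)
        (hc.stronglyMeasurableAtFilter _ _) hc.continuousAt
      simpa using this
    have h2 := (hasDerivAt_iff_tendsto_slope_zero.1 h1)
    have h3 : Tendsto (fun h : ℝ≥0 => (h : ℝ)) (𝓝[>] 0) (𝓝[≠] 0) := by
      refine tendsto_nhdsWithin_iff.2 ⟨?_, ?_⟩
      · exact (NNReal.continuous_coe.tendsto 0).mono_left nhdsWithin_le_nhds
      · filter_upwards [self_mem_nhdsWithin] with h hh
        simpa using (ne_of_gt hh)
    refine (h2.comp h3).congr fun h => ?_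
    simp only [Function.comp, integral_same, sub_zero]
    rw [← Complex.ofReal_inv]
    rfl
  -- After a shift of the variable, T(h)∫₀ᵗ - ∫₀ᵗ equals ∫ₜ^{t+h} - ∫₀ʰ; each term divided by h
  -- converges.
  have h0 := (hder t).sub (hder 0)
  rw [T.op_zero_apply] at h0
  refine h0.congr fun h => ?_
  rw [← smul_sub]
  congr 1
  rw [← ContinuousLinearMap.intervalIntegral_comp_comm _ (hi _ _)]
  have hshift : ∫ s in (0 : ℝ)..t, T.op h (T.op s.toNNReal f)
      = ∫ s in (h : ℝ)..(t + h), T.op s.toNNReal f := by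
    have := integral_comp_add_right (a := 0) (b := (t : ℝ)) (fun s : ℝ => T.op s.toNNReal f) (h : ℝ)
    rw [zero_add] at this
    rw [← this]
    refine integral_congr fun s hs => ?_
    rw [Set.uIcc_of_le t.coe_nonneg] at hs
    rw [Real.toNNReal_add hs.1 h.coe_nonneg, Real.toNNReal_coe, add_comm, T.op_add_apply]
  rw [hshift]
  simp only [NNReal.coe_zero, zero_add]
  rw [sub_eq_sub_iff_add_eq_add, add_comm (∫ s in (t : ℝ).._, _),
    integral_add_adjacent_intervals (hi _ _) (hi _ _),
    add_comm (∫ s in (h : ℝ).._, _),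
    integral_add_adjacent_intervals (hi _ _) (hi _ _)]

/-- The averages (1/t)∫₀ᵗ T(s)f ds lie in the domain, stay in the closed convex set K, and tend to
f. -/
theorem mem_closure_domain_inter [CompleteSpace E] (T : C0Semigroup E) {K : Set E}
    (hK : ∀ f ∈ K, ∀ g ∈ K, ∀ a b : ℝ, 0 ≤ a → 0 ≤ b → a + b = 1 → (a : ℂ) • f + (b : ℂ) • g ∈ K)
    (hKc : IsClosed K) {f : E} (hf : ∀ t, T.op t f ∈ K) :
    f ∈ closure ((T.generator.domain : Set E) ∩ K) := by
  have hc : Continuous fun s : ℝ => T.op s.toNNReal f :=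
    (T.continuous_orbit f).comp continuous_real_toNNReal
  have h1 : HasDerivAt (fun u : ℝ => ∫ s in (0 : ℝ)..u, T.op s.toNNReal f) f 0 := by
    have := intervalIntegral.integral_hasDerivAt_right (hc.intervalIntegrable 0 0)
      (hc.stronglyMeasurableAtFilter _ _) hc.continuousAt
    simpa [T.op_zero_apply] using this
  have h2 := (hasDerivAt_iff_tendsto_slope_zero.1 h1).mono_left
    (nhdsWithin_mono 0 (show Set.Ioi (0 : ℝ) ⊆ {0}ᶜ from fun x hx => ne_of_gt hx))
  refine mem_closure_of_tendsto h2 ?_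
  filter_upwards [self_mem_nhdsWithin] with t (ht : 0 < t)
  simp only [zero_add, intervalIntegral.integral_same, sub_zero]
  constructor
  · lift t to ℝ≥0 using ht.le
    have := T.generator.domain.smul_mem ((t⁻¹ : ℝ) : ℂ) (T.integral_orbit_mem_domain f t)
    exact this
  · have hconv : Convex ℝ K := fun f hf g hg a b ha hb hab => hK f hf g hg a b ha hb hab
    have := hconv.set_average_mem (μ := volume) (t := Set.Ioc 0 t)
      (f := fun s : ℝ => T.op s.toNNReal f) hKc
      (by simp [ht]) (by simp) (Eventually.of_forall fun s => hf _)
      ((hc.intervalIntegrable 0 t).1)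
    rw [setAverage_eq, ← intervalIntegral.integral_of_le ht.le] at this
    simpa [Measure.real, ht.le] using this

end C0Semigroup

noncomputable section

/-! ### Products of bounded functions with elements of L¹. -/

section BoundedMultiplication

variable {X : Type*} [MeasurableSpace X] {μ : Measure X}

/-- `|f| ≤ C` almost everywhere. -/
def BddBy (C : ℝ) (f : Lp ℂ 1 μ) : Prop := ∀ᵐ x ∂μ, ‖f x‖ ≤ C

theorem BddBy.mono {C D : ℝ} {f : Lp ℂ 1 μ} (h : BddBy C f) (hCD : C ≤ D) : BddBy D f :=
  Eventually.mono h fun _ hx => hx.trans hCD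

theorem mem_LInfty_iff {f : Lp ℂ 1 μ} : f ∈ LInfty μ ↔ ∃ C, BddBy C f := by
  refine ⟨fun h => ⟨(eLpNormEssSup f μ).toReal, ?_⟩, fun ⟨C, hC⟩ => ?_⟩
  · have h' : MemLp f ∞ μ := h
    have := ae_le_eLpNormEssSup (f := (f : X → ℂ)) (μ := μ)
    filter_upwards [this] with x hx
    have hfin : eLpNormEssSup f μ ≠ ∞ := by
      simpa using h'.2.ne
    exact (ENNReal.toReal_mono hfin hx).trans' (by simp)
  · exact memLp_top_of_bound (Lp.aestronglyMeasurable f) C hC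

theorem BddBy.mem_LInfty {C : ℝ} {f : Lp ℂ 1 μ} (h : BddBy C f) : f ∈ LInfty μ :=
  mem_LInfty_iff.2 ⟨C, h⟩

theorem exists_seq_tendsto_ae_of_tendsto {u : ℕ → Lp ℂ 1 μ} {f : Lp ℂ 1 μ}
    (h : Tendsto u atTop (𝓝 f)) :
    ∃ ns : ℕ → ℕ, ∀ᵐ x ∂μ, Tendsto (fun i => u (ns i) x) atTop (𝓝 (f x)) := by
  obtain ⟨ns, -, hns⟩ := (tendstoInMeasure_of_tendsto_Lp h).exists_seq_tendsto_ae
  exact ⟨ns, hns⟩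

/-- A pointwise closed condition that holds a.e. defines a closed subset of `L¹`. -/
theorem isClosed_setOf_ae_mem {K : Set ℂ} (hK : IsClosed K) :
    IsClosed {f : Lp ℂ 1 μ | ∀ᵐ x ∂μ, f x ∈ K} := by
  refine IsSeqClosed.isClosed fun u f hu hf => ?_
  obtain ⟨ns, hns⟩ := exists_seq_tendsto_ae_of_tendsto hf
  filter_upwards [hns, ae_all_iff.2 hu] with x hx hux
  exact hK.mem_of_tendsto hx (Eventually.of_forall fun i => hux (ns i))

/-- Membership in L^∞ is lost in L¹-limits, but a bound with a fixed constant survives; this is why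
constants are carried along. -/
theorem isClosed_BddBy (C : ℝ) : IsClosed {f : Lp ℂ 1 μ | BddBy C f} := by
  have := isClosed_setOf_ae_mem (μ := μ) (Metric.isClosed_closedBall (x := (0 : ℂ)) (ε := C))
  simpa [BddBy] using this

theorem BddBy.convex_comb {C : ℝ} {f g : Lp ℂ 1 μ} (hf : BddBy C f) (hg : BddBy C g) {a b : ℝ}
    (ha : 0 ≤ a) (hb : 0 ≤ b) (hab : a + b = 1) : BddBy C ((a : ℂ) • f + (b : ℂ) • g) := by
  filter_upwards [Lp.coeFn_add ((a : ℂ) • f) ((b : ℂ) • g), Lp.coeFn_smul (a : ℂ) f,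
    Lp.coeFn_smul (b : ℂ) g, hf, hg] with x e1 e2 e3 hfx hgx
  rw [e1, Pi.add_apply, e2, e3]
  refine (norm_add_le _ _).trans ?_
  simp only [Pi.smul_apply, norm_smul, Complex.norm_real, Real.norm_eq_abs, abs_of_nonneg ha,
    abs_of_nonneg hb]
  calc a * ‖f x‖ + b * ‖g x‖ ≤ a * C + b * C := by gcongr
    _ = C := by rw [← add_mul, hab, one_mul]

theorem BddBy.star {C : ℝ} {f : Lp ℂ 1 μ} (h : BddBy C f) : BddBy C (star f) := by
  filter_upwards [h, Lp.coeFn_star f] with x hx e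
  rw [e]
  simpa using hx

theorem norm_star_Lp (f : Lp ℂ 1 μ) : ‖star f‖ = ‖f‖ := by
  refine le_antisymm (Lp.norm_le_norm_of_ae_le ?_) (Lp.norm_le_norm_of_ae_le ?_) <;>
  · filter_upwards [Lp.coeFn_star f] with x hx
    rw [hx]
    simp

theorem star_add_Lp (f g : Lp ℂ 1 μ) : star (f + g) = star f + star g := by
  apply Lp.ext
  filter_upwards [Lp.coeFn_star f, Lp.coeFn_star g, Lp.coeFn_star (f + g), Lp.coeFn_add f g,
    Lp.coeFn_add (star f) (star g)] with x h1 h2 h3 h4 h5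
  rw [h3, h5, Pi.star_apply, h4, Pi.add_apply, Pi.add_apply, h1, h2, star_add]
  rfl

theorem star_smul_Lp (c : ℂ) (f : Lp ℂ 1 μ) : star (c • f) = star c • star f := by
  apply Lp.ext
  filter_upwards [Lp.coeFn_star f, Lp.coeFn_star (c • f), Lp.coeFn_smul c f,
    Lp.coeFn_smul (star c) (star f)] with x h1 h2 h3 h4
  rw [h2, h4, Pi.star_apply, h3, Pi.smul_apply, Pi.smul_apply, h1, star_smul]
  rfl

theorem star_sub_Lp (f g : Lp ℂ 1 μ) : star (f - g) = star f - star g := by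
  rw [eq_sub_iff_add_eq, ← star_add_Lp, sub_add_cancel]

theorem continuous_star_Lp : Continuous (fun f : Lp ℂ 1 μ => star f) := by
  refine continuous_iff_continuousAt.2 fun f => tendsto_iff_norm_sub_tendsto_zero.2 ?_
  simp only [← star_sub_Lp, norm_star_Lp]
  exact tendsto_iff_norm_sub_tendsto_zero.1 tendsto_id

open Classical in
/-- The product `f g`, for `f` bounded, and `0` otherwise. -/
def pmul (f g : Lp ℂ 1 μ) : Lp ℂ 1 μ := if hf : f ∈ LInfty μ then bmul ⟨f, hf⟩ g else 0

theorem pmul_eq_bmul {f : Lp ℂ 1 μ} (hf : f ∈ LInfty μ) (g : Lp ℂ 1 μ) :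
    pmul f g = bmul ⟨f, hf⟩ g :=
  dif_pos hf

theorem coeFn_pmul {f : Lp ℂ 1 μ} (hf : f ∈ LInfty μ) (g : Lp ℂ 1 μ) :
    pmul f g =ᵐ[μ] fun x => f x * g x := by
  rw [pmul_eq_bmul hf]
  exact MemLp.coeFn_toLp _

theorem pmul_add {f : Lp ℂ 1 μ} (hf : f ∈ LInfty μ) (g h : Lp ℂ 1 μ) :
    pmul f (g + h) = pmul f g + pmul f h := by
  apply Lp.ext
  filter_upwards [coeFn_pmul hf (g + h), coeFn_pmul hf g, coeFn_pmul hf h, Lp.coeFn_add g h,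
    Lp.coeFn_add (pmul f g) (pmul f h)] with x h1 h2 h3 h4 h5
  rw [h1, h5, Pi.add_apply, h2, h3, h4, Pi.add_apply, mul_add]

theorem pmul_smul {f : Lp ℂ 1 μ} (hf : f ∈ LInfty μ) (c : ℂ) (g : Lp ℂ 1 μ) :
    pmul f (c • g) = c • pmul f g := by
  apply Lp.ext
  filter_upwards [coeFn_pmul hf (c • g), coeFn_pmul hf g, Lp.coeFn_smul c g,
    Lp.coeFn_smul c (pmul f g)] with x h1 h2 h3 h4
  rw [h1, h4, Pi.smul_apply, h2, h3, Pi.smul_apply, smul_eq_mul, smul_eq_mul]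
  ring

theorem pmul_sub {f : Lp ℂ 1 μ} (hf : f ∈ LInfty μ) (g h : Lp ℂ 1 μ) :
    pmul f (g - h) = pmul f g - pmul f h := by
  rw [eq_sub_iff_add_eq, ← pmul_add hf, sub_add_cancel]

theorem pmul_comm {f g : Lp ℂ 1 μ} (hf : f ∈ LInfty μ) (hg : g ∈ LInfty μ) :
    pmul f g = pmul g f := by
  apply Lp.ext
  filter_upwards [coeFn_pmul hf g, coeFn_pmul hg f] with x h1 h2
  rw [h1, h2, mul_comm]

theorem sub_pmul {f g : Lp ℂ 1 μ} (hf : f ∈ LInfty μ) (hg : g ∈ LInfty μ) (h : Lp ℂ 1 μ) :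
    pmul (f - g) h = pmul f h - pmul g h := by
  apply Lp.ext
  filter_upwards [coeFn_pmul hf h, coeFn_pmul hg h, coeFn_pmul (sub_mem hf hg) h,
    Lp.coeFn_sub f g, Lp.coeFn_sub (pmul f h) (pmul g h)] with x h1 h2 h3 h4 h5
  rw [h3, h5, Pi.sub_apply, h1, h2, h4, Pi.sub_apply, sub_mul]

theorem norm_pmul_le {C : ℝ} {f : Lp ℂ 1 μ} (hf : BddBy C f) (g : Lp ℂ 1 μ) :
    ‖pmul f g‖ ≤ C * ‖g‖ := by
  refine Lp.norm_le_mul_norm_of_ae_le_mul ?_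
  filter_upwards [coeFn_pmul hf.mem_LInfty g, hf] with x h1 h2
  rw [h1, norm_mul]
  gcongr

theorem BddBy.pmul {C D : ℝ} (hC : 0 ≤ C) {f g : Lp ℂ 1 μ} (hf : BddBy C f) (hg : BddBy D g) :
    BddBy (C * D) (pmul f g) := by
  filter_upwards [coeFn_pmul hf.mem_LInfty g, hf, hg] with x h1 h2 h3
  rw [h1, norm_mul]
  gcongr

theorem pmul_mem {f g : Lp ℂ 1 μ} (hf : f ∈ LInfty μ) (hg : g ∈ LInfty μ) :
    pmul f g ∈ LInfty μ := by
  obtain ⟨C, hC⟩ := mem_LInfty_iff.1 hf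
  obtain ⟨D, hD⟩ := mem_LInfty_iff.1 hg
  exact ((hC.mono (le_max_left C 0)).pmul (le_max_right _ _) hD).mem_LInfty

theorem star_mem_LInfty {f : Lp ℂ 1 μ} (hf : f ∈ LInfty μ) : star f ∈ LInfty μ := by
  obtain ⟨C, hC⟩ := mem_LInfty_iff.1 hf
  exact hC.star.mem_LInfty

theorem continuous_pmul {f : Lp ℂ 1 μ} (hf : f ∈ LInfty μ) : Continuous fun g => pmul f g := by
  obtain ⟨C, hC⟩ := mem_LInfty_iff.1 hf
  refine continuous_iff_continuousAt.2 fun g => tendsto_iff_norm_sub_tendsto_zero.2 ?_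
  have h : Tendsto (fun g' => C * ‖g' - g‖) (𝓝 g) (𝓝 0) := by
    simpa using (tendsto_iff_norm_sub_tendsto_zero.1 (tendsto_id (x := 𝓝 g))).const_mul C
  refine squeeze_zero (fun _ => norm_nonneg _) (fun g' => ?_) h
  rw [← pmul_sub hf]
  exact norm_pmul_le hC _

theorem simpleFunc_mem_LInfty (f : Lp.simpleFunc ℂ 1 μ) : (f : Lp ℂ 1 μ) ∈ LInfty μ := by
  obtain ⟨C, hC⟩ := (Lp.simpleFunc.toSimpleFunc f).exists_forall_norm_le
  refine mem_LInfty_iff.2 ⟨C, ?_⟩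
  filter_upwards [Lp.simpleFunc.toSimpleFunc_eq_toFun f] with x hx
  rw [← hx]
  exact hC x

theorem integral_add_Lp (f g : Lp ℂ 1 μ) :
    ∫ x, (f + g : Lp ℂ 1 μ) x ∂μ = ∫ x, f x ∂μ + ∫ x, g x ∂μ := by
  rw [integral_congr_ae (Lp.coeFn_add f g)]
  exact integral_add (L1.integrable_coeFn f) (L1.integrable_coeFn g)

theorem integral_smul_Lp (c : ℂ) (f : Lp ℂ 1 μ) :
    ∫ x, (c • f : Lp ℂ 1 μ) x ∂μ = c • ∫ x, f x ∂μ := by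
  rw [integral_congr_ae (Lp.coeFn_smul c f)]
  exact integral_const_mul c _

theorem dense_LInfty : Dense (LInfty μ : Set (Lp ℂ 1 μ)) :=
  (Lp.simpleFunc.dense (E := ℂ) (μ := μ) ENNReal.one_ne_top).mono
    fun f hf => simpleFunc_mem_LInfty ⟨f, hf⟩

/-- The product of a uniformly bounded `L¹`-convergent family and an `L¹`-convergent family
converges in `L¹`. -/
theorem tendsto_pmul {ι : Type*} {l : Filter ι} {u v : ι → Lp ℂ 1 μ} {f g : Lp ℂ 1 μ} {C : ℝ}
    (hu : Tendsto u l (𝓝 f)) (hC : ∀ᶠ i in l, BddBy C (u i)) (hf : BddBy C f)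
    (hv : Tendsto v l (𝓝 g)) :
    Tendsto (fun i => pmul (u i) (v i)) l (𝓝 (pmul f g)) := by
  rw [tendsto_iff_norm_sub_tendsto_zero]
  have hv' := tendsto_iff_norm_sub_tendsto_zero.1 hv
  have hu' := tendsto_iff_norm_sub_tendsto_zero.1 hu
  rw [Metric.tendsto_nhds]
  intro ε hε
  -- The family `u` is small only in L¹, so `u i - f` cannot be multiplied by `g` directly.
  -- Replacing `g` by a bounded `k` leaves two errors of at most ε/4 each; the 1 in |C| + 1 covers C
  -- = 0.
  obtain ⟨k, hk, hkg⟩ := Metric.mem_closure_iff.1 (dense_LInfty (μ := μ) g) (ε / (4 * (|C| + 1)))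
    (by positivity)
  obtain ⟨D, hD⟩ := mem_LInfty_iff.1 (show k ∈ LInfty μ from hk)
  have e1 : Tendsto (fun i => C * ‖v i - g‖ + D * ‖u i - f‖) l (𝓝 0) := by
    simpa using (hv'.const_mul C).add (hu'.const_mul D)
  filter_upwards [hC, Metric.tendsto_nhds.1 e1 (ε / 2) (by positivity)] with i hi h2
  have hui := hi.mem_LInfty
  have hfi := hf.mem_LInfty
  have hsplit : pmul (u i) (v i) - pmul f g
      = pmul (u i) (v i - g) + pmul k (u i - f) + (pmul (u i) (g - k) - pmul f (g - k)) := by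
    rw [pmul_comm hk (sub_mem hui hfi), sub_pmul hui hfi, pmul_sub hui, pmul_sub hui, pmul_sub hfi]
    abel
  rw [Real.dist_eq, sub_zero, abs_of_nonneg (norm_nonneg _), hsplit]
  rw [Real.dist_eq, sub_zero] at h2
  have hgk : ‖g - k‖ < ε / (4 * (|C| + 1)) := by rwa [← dist_eq_norm]
  have h3 : |C| * ‖g - k‖ ≤ ε / 4 := by
    have : (|C| + 1) * (ε / (4 * (|C| + 1))) = ε / 4 := by
      field_simp
    rw [← this]
    gcongr
    linarith
  have h4 : C * ‖g - k‖ ≤ ε / 4 :=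
    (mul_le_mul_of_nonneg_right (le_abs_self C) (norm_nonneg _)).trans h3
  calc _ ≤ ‖pmul (u i) (v i - g)‖ + ‖pmul k (u i - f)‖
        + (‖pmul (u i) (g - k)‖ + ‖pmul f (g - k)‖) :=
        (norm_add_le _ _).trans (add_le_add (norm_add_le _ _) (norm_sub_le _ _))
    _ ≤ C * ‖v i - g‖ + D * ‖u i - f‖ + (C * ‖g - k‖ + C * ‖g - k‖) := by
        gcongr
        exacts [norm_pmul_le hi _, norm_pmul_le hD _, norm_pmul_le hi _, norm_pmul_le hf _]
    _ < ε := by linarith [le_abs_self (C * ‖v i - g‖ + D * ‖u i - f‖)]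

variable (μ) in
/-- The integral as a continuous linear functional on `L¹`. -/
def integralL1 : Lp ℂ 1 μ →L[ℂ] ℂ :=
  LinearMap.mkContinuous
    { toFun := fun f => ∫ x, f x ∂μ
      map_add' := integral_add_Lp
      map_smul' := integral_smul_Lp } 1 fun f => by
    rw [one_mul, L1.norm_eq_integral_norm]
    exact norm_integral_le_integral_norm _

theorem integralL1_apply (f : Lp ℂ 1 μ) : integralL1 μ f = ∫ x, f x ∂μ := rfl

section Finite

variable [IsFiniteMeasure μ]

variable (μ) in
/-- The inclusion of `L^∞` in `L¹`. -/
def LinftyToL1 : Lp ℂ ∞ μ →ₗ[ℂ] Lp ℂ 1 μ where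
  toFun f := ⟨f, Lp.antitone le_top f.2⟩
  map_add' _ _ := rfl
  map_smul' _ _ := rfl

theorem coeFn_LinftyToL1 (f : Lp ℂ ∞ μ) : (LinftyToL1 μ f : X → ℂ) = f := rfl

theorem LinftyToL1_injective : Function.Injective (LinftyToL1 μ) := by
  intro f g h
  have := congrArg (fun k : Lp ℂ 1 μ => (k : X →ₘ[μ] ℂ)) h
  exact Subtype.ext this

theorem bddBy_norm (f : Lp ℂ ∞ μ) : BddBy ‖f‖ (LinftyToL1 μ f) := by
  filter_upwards [ae_le_eLpNormEssSup (f := (f : X → ℂ)) (μ := μ)] with x hx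
  rw [coeFn_LinftyToL1, Lp.norm_def, eLpNorm_exponent_top]
  refine (ENNReal.toReal_mono ?_ hx).trans' (by simp)
  rw [← eLpNorm_exponent_top]
  exact Lp.eLpNorm_ne_top f

theorem continuous_LinftyToL1 : Continuous (LinftyToL1 μ) := by
  refine AddMonoidHomClass.continuous_of_bound (LinftyToL1 μ)
    (measureUnivNNReal μ ^ (1 : ℝ≥0∞).toReal⁻¹ : ℝ) fun f => ?_
  exact Lp.norm_le_of_ae_bound (norm_nonneg _) (bddBy_norm f)

/-- An operator on `L¹` that leaves `L^∞` invariant is bounded on `L^∞`. -/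
theorem exists_bound_of_invariant (T : Lp ℂ 1 μ →L[ℂ] Lp ℂ 1 μ)
    (hT : ∀ f ∈ LInfty μ, T f ∈ LInfty μ) :
    ∃ M : ℝ, 0 ≤ M ∧ ∀ (C : ℝ) (f : Lp ℂ 1 μ), 0 ≤ C → BddBy C f → BddBy (M * C) (T f) := by
  have hmem : ∀ f : Lp ℂ ∞ μ, LinftyToL1 μ f ∈ LInfty μ := fun f => (bddBy_norm f).mem_LInfty
  have hlift : ∀ g : Lp ℂ 1 μ, g ∈ LInfty μ → ∃ h : Lp ℂ ∞ μ, LinftyToL1 μ h = g :=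
    fun g hg => ⟨⟨g, Lp.mem_Lp_iff_memLp.2 hg⟩, rfl⟩
  choose S hS using fun f : Lp ℂ ∞ μ => hlift _ (hT _ (hmem f))
  let S' : Lp ℂ ∞ μ →ₗ[ℂ] Lp ℂ ∞ μ :=
    { toFun := S
      map_add' := fun f g => LinftyToL1_injective (by simp only [map_add, hS])
      map_smul' := fun c f => LinftyToL1_injective (by simp only [map_smul, hS, RingHom.id_apply]) }
  -- Closed graph: convergence in L^∞ implies convergence in L¹, where T is continuous, so the two
  -- limits agree.
  have hcont : Continuous S' := S'.continuous_of_seq_closed_graph fun u f g hu hg => by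
    refine LinftyToL1_injective (tendsto_nhds_unique
      ((continuous_LinftyToL1.tendsto g).comp hg) ?_)
    have := ((T.continuous.comp continuous_LinftyToL1).tendsto f).comp hu
    refine (this.congr fun n => (hS (u n)).symm).trans (le_of_eq ?_)
    exact congrArg 𝓝 (hS f).symm
  let S'' : Lp ℂ ∞ μ →L[ℂ] Lp ℂ ∞ μ := ⟨S', hcont⟩
  refine ⟨‖S''‖, norm_nonneg _, fun C f hC hf => ?_⟩
  obtain ⟨h, rfl⟩ := hlift f hf.mem_LInfty
  have hn : ‖h‖ ≤ C := by
    simpa using Lp.norm_le_of_ae_bound (f := h) hC hf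
  rw [← hS h]
  refine (bddBy_norm (S h)).mono ?_
  exact (S''.le_opNorm h).trans (by gcongr)

end Finite

end BoundedMultiplication

/-! ### Indicators of elements of the measure algebra. -/

namespace MeasureAlg

variable {X : Type*} [MeasurableSpace X] {μ : Measure X} [IsProbabilityMeasure μ]

theorem coeFn_indicator_mk {s : Set X} (hs : MeasurableSet s) :
    (mk μ s hs).indicator =ᵐ[μ] s.indicator fun _ => (1 : ℂ) :=
  indicatorConstLp_coeFn (hs := hs) (hμs := measure_ne_top μ s)

theorem bddBy_indicator (M : MeasureAlg μ) : BddBy 1 M.indicator := by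
  induction M using MeasureAlg.ind with
  | h s hs =>
    filter_upwards [coeFn_indicator_mk hs] with x hx
    rw [hx]
    by_cases h : x ∈ s <;> simp [h]

theorem indicator_injective : Function.Injective (indicator : MeasureAlg μ → Lp ℂ 1 μ) := by
  intro M N
  induction M using MeasureAlg.ind with
  | h s hs =>
    induction N using MeasureAlg.ind with
    | h t ht =>
      intro h
      exact Quotient.sound ((indicatorConstLp_inj hs (measure_ne_top μ s) ht (measure_ne_top μ t)
        (one_ne_zero (α := ℂ))).1 h)

/-- Inclusion–exclusion: a linear operator that respects intersections of indicators respects their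
unions as well. -/
theorem indicator_sup (M N : MeasureAlg μ) :
    (M ⊔ N).indicator = M.indicator + N.indicator - (M ⊓ N).indicator := by
  induction M using MeasureAlg.ind with
  | h s hs =>
    induction N using MeasureAlg.ind with
    | h t ht =>
      rw [mk_sup_mk, mk_inf_mk]
      apply Lp.ext
      filter_upwards [coeFn_indicator_mk (μ := μ) hs, coeFn_indicator_mk (μ := μ) ht,
        coeFn_indicator_mk (μ := μ) (hs.union ht), coeFn_indicator_mk (μ := μ) (hs.inter ht),
        Lp.coeFn_sub ((mk μ s hs).indicator + (mk μ t ht).indicator)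
          (mk μ _ (hs.inter ht)).indicator,
        Lp.coeFn_add (mk μ s hs).indicator (mk μ t ht).indicator] with x h1 h2 h3 h4 h5 h6
      rw [h5, Pi.sub_apply, h6, Pi.add_apply, h1, h2, h3, h4]
      by_cases hxs : x ∈ s <;> by_cases hxt : x ∈ t <;> simp [hxs, hxt]

theorem pmul_indicator (M N : MeasureAlg μ) :
    pmul M.indicator N.indicator = (M ⊓ N).indicator := by
  have hM := (bddBy_indicator M).mem_LInfty
  induction M using MeasureAlg.ind with
  | h s hs =>
    induction N using MeasureAlg.ind with
    | h t ht =>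
      rw [mk_inf_mk]
      apply Lp.ext
      filter_upwards [coeFn_indicator_mk (μ := μ) hs, coeFn_indicator_mk (μ := μ) ht,
        coeFn_indicator_mk (μ := μ) (hs.inter ht), coeFn_pmul hM (mk μ t ht).indicator]
        with x h1 h2 h3 h4
      rw [h4, h1, h2, h3]
      by_cases hxs : x ∈ s <;> by_cases hxt : x ∈ t <;> simp [hxs, hxt]

theorem integral_indicator (M : MeasureAlg μ) :
    ∫ x, M.indicator x ∂μ = ((M.measure).toReal : ℂ) := by
  induction M using MeasureAlg.ind with
  | h s hs =>
    rw [integral_congr_ae (coeFn_indicator_mk hs), MeasureTheory.integral_indicator hs]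
    simp [Measure.real]
    rfl

theorem measure_ne_top' (M : MeasureAlg μ) : M.measure ≠ ∞ := by
  induction M using MeasureAlg.ind with
  | h s hs => exact MeasureTheory.measure_ne_top μ s

/-- An element of `L¹` with values in `{0, 1}` is an indicator function. -/
theorem exists_eq_indicator {f : Lp ℂ 1 μ} (hf : ∀ᵐ x ∂μ, f x = 0 ∨ f x = 1) :
    ∃ M : MeasureAlg μ, f = M.indicator := by
  have hm : MeasurableSet {x | f x = 1} :=
    (Lp.stronglyMeasurable f).measurable (measurableSet_singleton 1)
  refine ⟨mk μ _ hm, Lp.ext ?_⟩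
  filter_upwards [hf, coeFn_indicator_mk (μ := μ) hm] with x hx h1
  rw [h1]
  rcases hx with hx | hx <;> simp [Set.indicator, hx]

/-- An operator on `L¹` mapping indicators to indicators, compatibly with intersections and
preserving integrals, is induced by a measure algebra homomorphism. -/
theorem exists_measureAlgHom (T : Lp ℂ 1 μ →L[ℂ] Lp ℂ 1 μ)
    (hT : ∀ M : MeasureAlg μ, ∃ N : MeasureAlg μ, T M.indicator = N.indicator)
    (hinf : ∀ M N M' N' : MeasureAlg μ, T M.indicator = M'.indicator →
      T N.indicator = N'.indicator → T (M ⊓ N).indicator = (M' ⊓ N').indicator)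
    (hint : ∀ f : Lp ℂ 1 μ, ∫ x, T f x ∂μ = ∫ x, f x ∂μ) :
    ∃ φ : MeasureAlgHom μ, ∀ M : MeasureAlg μ,
        T M.indicator = (φ.toLatticeHom M).indicator := by
  choose φ hφ using hT
  have hφinf : ∀ M N, φ (M ⊓ N) = φ M ⊓ φ N := fun M N =>
    indicator_injective ((hφ _).symm.trans (hinf M N _ _ (hφ M) (hφ N)))
  have hφsup : ∀ M N, φ (M ⊔ N) = φ M ⊔ φ N := fun M N => indicator_injective <| by
    rw [← hφ, indicator_sup, map_sub, map_add, hφ, hφ, hφ, hφinf, ← indicator_sup]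
  refine ⟨⟨⟨⟨φ, hφsup⟩, hφinf⟩, fun M => ?_⟩, hφ⟩
  have h := hint M.indicator
  rw [hφ, integral_indicator, integral_indicator] at h
  exact (ENNReal.toReal_eq_toReal_iff' (measure_ne_top' _) (measure_ne_top' _)).1
    (Complex.ofReal_injective h)

end MeasureAlg

/-! ### From a derivation to a multiplicative semigroup. -/

section Derivation

variable {X : Type*} [MeasurableSpace X] {μ : Measure X}

theorem coeFn_oneL [IsProbabilityMeasure μ] : oneL μ =ᵐ[μ] fun _ => (1 : ℂ) := Lp.coeFn_const 1 μ 1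

theorem bddBy_oneL [IsProbabilityMeasure μ] : BddBy 1 (oneL μ) := by
  filter_upwards [coeFn_oneL (μ := μ)] with x hx
  simp [hx]

theorem oneL_pmul [IsProbabilityMeasure μ] (f : Lp ℂ 1 μ) : pmul (oneL μ) f = f := by
  apply Lp.ext
  filter_upwards [coeFn_oneL (μ := μ), coeFn_pmul bddBy_oneL.mem_LInfty f] with x h1 h2
  rw [h2, h1, one_mul]

theorem BddBy.nonneg [IsProbabilityMeasure μ] {C : ℝ} {f : Lp ℂ 1 μ} (h : BddBy C f) : 0 ≤ C := by
  obtain ⟨x, hx⟩ := Eventually.exists h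
  exact (norm_nonneg _).trans hx

/-- The generator of `T` acts on the bounded elements of its domain as a derivation whose range
is annihilated by `μ`. -/
structure IsBoundedDerivation (T : C0Semigroup (Lp ℂ 1 μ)) : Prop where
  mul : ∀ {f g f' g' : Lp ℂ 1 μ}, f ∈ LInfty μ → g ∈ LInfty μ → T.HasGenerator f f' →
    T.HasGenerator g g' → T.HasGenerator (pmul f g) (pmul g f' + pmul f g')
  star : ∀ {f f' : Lp ℂ 1 μ}, f ∈ LInfty μ → T.HasGenerator f f' →
    T.HasGenerator (star f) (star f')
  integral_eq_zero : ∀ {f f' : Lp ℂ 1 μ}, T.HasGenerator f f' → ∫ x, f' x ∂μ = 0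

/-- A solution of `F' = A F` on the set `S` of times, with locally bounded values in `L^∞`. -/
structure BoundedSolution (T : C0Semigroup (Lp ℂ 1 μ)) (S : Set ℝ≥0) (F : ℝ≥0 → Lp ℂ 1 μ) :
    Prop where
  continuousAt : ∀ r ∈ S, ContinuousAt F r
  bdd : ∀ r ∈ S, ∃ C, ∀ᶠ s in 𝓝 r, BddBy C (F s)
  deriv : ∀ r ∈ S, ∃ g, T.HasGenerator (F r) g ∧ C0Semigroup.HasRightDeriv F g r

/-- Writing the increment as G(r)(F(r+h) - F(r)) + F(r+h)(G(r+h) - G(r)) requires a local bound for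
F only, and boundedness of G just at r. -/
theorem hasRightDeriv_pmul {F G : ℝ≥0 → Lp ℂ 1 μ} {f' g' : Lp ℂ 1 μ}
    {r : ℝ≥0} {C : ℝ} (hFc : ContinuousAt F r) (hC : ∀ᶠ s in 𝓝 r, BddBy C (F s))
    (hGr : G r ∈ LInfty μ) (hf' : C0Semigroup.HasRightDeriv F f' r)
    (hg' : C0Semigroup.HasRightDeriv G g' r) :
    C0Semigroup.HasRightDeriv (fun r => pmul (F r) (G r)) (pmul (G r) f' + pmul (F r) g') r := by
  have hadd := C0Semigroup.tendsto_nhdsGT_zero_add r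
  have h1 := tendsto_pmul (hFc.tendsto.comp hadd) (hadd.eventually hC) hC.self_of_nhds hg'
  have h2 := ((continuous_pmul hGr).tendsto _).comp hf'
  have hFr := hC.self_of_nhds.mem_LInfty
  refine (h2.add h1).congr' ?_
  filter_upwards [hadd.eventually hC] with h hh
  have hFh := hh.mem_LInfty
  simp only [Function.comp]
  rw [pmul_smul hGr, pmul_smul hFh, ← smul_add, pmul_comm hGr (sub_mem hFh hFr),
    sub_pmul hFh hFr, pmul_sub hFh]
  congr 1
  abel

namespace BoundedSolution

variable {T : C0Semigroup (Lp ℂ 1 μ)} {S : Set ℝ≥0} {F G : ℝ≥0 → Lp ℂ 1 μ}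

theorem mem_LInfty (hF : BoundedSolution T S F) {r : ℝ≥0} (hr : r ∈ S) : F r ∈ LInfty μ := by
  obtain ⟨C, hC⟩ := hF.bdd r hr
  exact hC.self_of_nhds.mem_LInfty

/-- The product rule for curves and the Leibniz rule for the generator yield the same element of L¹.
-/
theorem mul (hT : IsBoundedDerivation T) (hF : BoundedSolution T S F)
    (hG : BoundedSolution T S G) : BoundedSolution T S fun r => pmul (F r) (G r) where
  continuousAt r hr := by
    obtain ⟨C, hC⟩ := hF.bdd r hr
    exact tendsto_pmul (hF.continuousAt r hr) hC hC.self_of_nhds (hG.continuousAt r hr)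
  bdd r hr := by
    obtain ⟨C, hC⟩ := hF.bdd r hr
    obtain ⟨D, hD⟩ := hG.bdd r hr
    refine ⟨max C 0 * D, ?_⟩
    filter_upwards [hC, hD] with s h1 h2
    exact (h1.mono (le_max_left _ _)).pmul (le_max_right _ _) h2
  deriv r hr := by
    obtain ⟨C, hC⟩ := hF.bdd r hr
    obtain ⟨f', hf, hf'⟩ := hF.deriv r hr
    obtain ⟨g', hg, hg'⟩ := hG.deriv r hr
    exact ⟨_, hT.mul (hF.mem_LInfty hr) (hG.mem_LInfty hr) hf hg,
      hasRightDeriv_pmul (hF.continuousAt r hr) hC (hG.mem_LInfty hr) hf' hg'⟩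

theorem star (hT : IsBoundedDerivation T) (hF : BoundedSolution T S F) :
    BoundedSolution T S fun r => star (F r) where
  continuousAt r hr := (continuous_star_Lp.tendsto _).comp (hF.continuousAt r hr)
  bdd r hr := by
    obtain ⟨C, hC⟩ := hF.bdd r hr
    exact ⟨C, hC.mono fun s hs => hs.star⟩
  deriv r hr := by
    obtain ⟨g, hg, hFg⟩ := hF.deriv r hr
    refine ⟨_, hT.star (hF.mem_LInfty hr) hg, ?_⟩
    refine ((continuous_star_Lp.tendsto _).comp hFg).congr fun h => ?_
    simp only [Function.comp, star_smul_Lp, star_sub_Lp]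
    simp

theorem integral_eq (hT : IsBoundedDerivation T) (hF : BoundedSolution T S F) {a b : ℝ≥0}
    (hab : a ≤ b) (hS : Set.Icc a b ⊆ S) : ∫ x, F b x ∂μ = ∫ x, F a x ∂μ := by
  refine C0Semigroup.eq_of_hasRightDeriv_zero (F := fun r => integralL1 μ (F r)) hab
    (fun r h1 h2 => ?_) (fun r h1 h2 => ?_)
  · exact ((integralL1 μ).continuous.tendsto _).comp (hF.continuousAt r (hS ⟨h1, h2⟩))
  · obtain ⟨g, hg, hFg⟩ := hF.deriv r (hS ⟨h1, h2.le⟩)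
    have := ((integralL1 μ).continuous.tendsto _).comp hFg
    rw [integralL1_apply, hT.integral_eq_zero hg] at this
    refine this.congr fun h => ?_
    simp only [Function.comp, map_smul, map_sub]

end BoundedSolution

variable {T : C0Semigroup (Lp ℂ 1 μ)}

theorem BoundedSolution.eq_op {F : ℝ≥0 → Lp ℂ 1 μ} (hF : BoundedSolution T Set.univ F) (t : ℝ≥0) :
    F t = T.op t (F 0) :=
  T.eq_op_of_hasRightDeriv (continuous_iff_continuousAt.2 fun r => hF.continuousAt r trivial)
    (fun r => hF.deriv r trivial) t

/-- On the domain, t ↦ ∫T(t)f has derivative ∫A T(t)f = 0; the rest is density. -/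
theorem integral_op_of_derivation (hT : IsBoundedDerivation T)
    (hd : Dense (T.generator.domain : Set (Lp ℂ 1 μ))) (t : ℝ≥0) (f : Lp ℂ 1 μ) :
    ∫ x, T.op t f x ∂μ = ∫ x, f x ∂μ := by
  refine isClosed_property (e := ((↑) : T.generator.domain → Lp ℂ 1 μ)) hd.denseRange_val
    (p := fun f => integralL1 μ (T.op t f) = integralL1 μ f)
    (isClosed_eq ((integralL1 μ).continuous.comp (T.op t).continuous) (integralL1 μ).continuous)
    (fun f => ?_) f
  obtain ⟨f, f', hf'⟩ := f
  have := C0Semigroup.eq_of_hasRightDeriv_zero (F := fun r => integralL1 μ (T.op r f))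
    (zero_le (a := t))
    (fun r _ _ => ((integralL1 μ).continuous.comp (T.continuous_orbit f)).continuousAt)
    (fun r _ _ => ?_)
  · simpa [T.op_zero_apply] using this
  · have h := ((integralL1 μ).continuous.tendsto _).comp (hf'.hasRightDeriv r)
    rw [integralL1_apply, hT.integral_eq_zero (hf'.op r)] at h
    refine h.congr fun h => ?_
    simp only [Function.comp, map_smul, map_sub]

/-! ### Conserved moments and the uniform L^∞ bound. -/

variable [IsProbabilityMeasure μ]

/-- Powers of a bounded function. -/
def npowL (f : Lp ℂ 1 μ) : ℕ → Lp ℂ 1 μ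
  | 0 => oneL μ
  | n + 1 => pmul f (npowL f n)

theorem coeFn_npowL {f : Lp ℂ 1 μ} (hf : f ∈ LInfty μ) (n : ℕ) :
    npowL f n =ᵐ[μ] fun x => f x ^ n := by
  induction n with
  | zero => simpa only [pow_zero, npowL] using coeFn_oneL
  | succ n ih =>
    filter_upwards [ih, coeFn_pmul hf (npowL f n)] with x h1 h2
    simp only [npowL]
    rw [h2, h1, pow_succ']

/-- For D > C, Chebyshev's inequality gives μ{|f| ≥ D} ≤ (C/D)^{2n} → 0. Even exponents suffice, and
|f|^{2n} = (f̄f)^n stays within the conjugation-invariant algebra. -/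
theorem bddBy_of_integral_pow_le {C : ℝ} (hC : 0 ≤ C) {f : Lp ℂ 1 μ} (hf : f ∈ LInfty μ)
    (h : ∀ n : ℕ, ∫ x, ‖f x‖ ^ (2 * n) ∂μ ≤ C ^ (2 * n)) : BddBy C f := by
  obtain ⟨K, hK⟩ := mem_LInfty_iff.1 hf
  have hint : ∀ n : ℕ, Integrable (fun x => ‖f x‖ ^ (2 * n)) μ := fun n => by
    refine Integrable.of_bound ((Lp.aestronglyMeasurable f).norm.pow _) (K ^ (2 * n)) ?_
    filter_upwards [hK] with x hx
    rw [norm_pow, norm_norm]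
    gcongr
  have key : ∀ D > C, μ {x | D ≤ ‖f x‖} = 0 := by
    intro D hD
    have hD0 : 0 < D := hC.trans_lt hD
    have hn : ∀ n : ℕ, μ.real {x | D ≤ ‖f x‖} ≤ ((C / D) ^ 2) ^ n := by
      intro n
      have h1 := mul_meas_ge_le_integral_of_nonneg (μ := μ)
        (Eventually.of_forall fun x => by positivity) (hint n) (D ^ (2 * n))
      have h2 : μ.real {x | D ≤ ‖f x‖} ≤ μ.real {x | D ^ (2 * n) ≤ ‖f x‖ ^ (2 * n)} :=
        measureReal_mono fun x (hx : D ≤ ‖f x‖) => pow_le_pow_left₀ hD0.le hx _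
      rw [← pow_mul, div_pow, le_div_iff₀ (by positivity), mul_comm]
      exact (mul_le_mul_of_nonneg_left h2 (by positivity)).trans (h1.trans (h n))
    have hlim : Tendsto (fun n : ℕ => ((C / D) ^ 2) ^ n) atTop (𝓝 0) := by
      refine tendsto_pow_atTop_nhds_zero_of_lt_one (by positivity) ?_
      exact pow_lt_one₀ (by positivity) ((div_lt_one hD0).2 hD) two_ne_zero
    have h0 : μ.real {x | D ≤ ‖f x‖} = 0 :=
      le_antisymm (ge_of_tendsto' hlim hn) measureReal_nonneg
    exact (measureReal_eq_zero_iff).1 h0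
  have hall : ∀ k : ℕ, ∀ᵐ x ∂μ, ‖f x‖ < C + 1 / ((k : ℝ) + 1) := fun k => by
    have := key (C + 1 / ((k : ℝ) + 1)) (by simp; positivity)
    rw [ae_iff]
    simpa only [not_lt] using this
  filter_upwards [ae_all_iff.2 hall] with x hx
  have : Tendsto (fun k : ℕ => C + 1 / ((k : ℝ) + 1)) atTop (𝓝 (C + 0)) :=
    tendsto_const_nhds.add tendsto_one_div_add_atTop_nhds_zero_nat
  rw [add_zero] at this
  exact ge_of_tendsto' this fun k => (hx k).le

theorem integral_npowL_star_mul {f : Lp ℂ 1 μ} (hf : f ∈ LInfty μ) (n : ℕ) :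
    ∫ x, npowL (pmul (star f) f) n x ∂μ = ((∫ x, ‖f x‖ ^ (2 * n) ∂μ : ℝ) : ℂ) := by
  rw [← integral_complex_ofReal]
  refine integral_congr_ae ?_
  have hs := star_mem_LInfty hf
  filter_upwards [coeFn_npowL (pmul_mem hs hf) n, coeFn_pmul hs f, Lp.coeFn_star f]
    with x h1 h2 h3
  rw [h1, h2, h3, Pi.star_apply, pow_mul]
  push_cast
  rw [← Complex.conj_mul']
  rfl

/-- The constant function `1` is annihilated by a derivation. -/
theorem IsBoundedDerivation.hasGenerator_one (hT : IsBoundedDerivation T)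
    (h1 : oneL μ ∈ T.generator.domain) : T.HasGenerator (oneL μ) 0 := by
  obtain ⟨g, hg⟩ := h1
  have hb := (bddBy_oneL (μ := μ)).mem_LInfty
  have := hT.mul hb hb hg hg
  rw [oneL_pmul, oneL_pmul] at this
  have h0 : g = g + g := hg.unique this
  rw [left_eq_add] at h0
  rwa [h0] at hg

theorem BoundedSolution.const_one (S : Set ℝ≥0) (h1 : T.HasGenerator (oneL μ) 0) :
    BoundedSolution T S fun _ => oneL μ where
  continuousAt _ _ := continuousAt_const
  bdd _ _ := ⟨1, Eventually.of_forall fun _ => bddBy_oneL⟩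
  deriv _ _ := ⟨0, h1, by simp [C0Semigroup.HasRightDeriv]⟩

theorem BoundedSolution.npowL {S : Set ℝ≥0} {F : ℝ≥0 → Lp ℂ 1 μ} (hT : IsBoundedDerivation T)
    (h1 : T.HasGenerator (oneL μ) 0) (hF : BoundedSolution T S F) (n : ℕ) :
    BoundedSolution T S fun r => npowL (F r) n := by
  induction n with
  | zero => exact BoundedSolution.const_one S h1
  | succ n ih => exact hF.mul hT ih

/-- The powers of F̄F are again solutions, so all even moments of F are constant on S. The bound
therefore passes backward in time as well as forward. -/
theorem BoundedSolution.bddBy_of_bddBy {S : Set ℝ≥0} {F : ℝ≥0 → Lp ℂ 1 μ}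
    (hT : IsBoundedDerivation T) (h1 : T.HasGenerator (oneL μ) 0) (hF : BoundedSolution T S F)
    [hS : S.OrdConnected] {a b : ℝ≥0} (ha : a ∈ S) (hb : b ∈ S) {C : ℝ} (hC : BddBy C (F a)) :
    BddBy C (F b) := by
  refine bddBy_of_integral_pow_le hC.nonneg (hF.mem_LInfty hb) fun n => ?_
  have hsol := ((hF.star hT).mul hT hF).npowL hT h1 n
  have heq : ∫ x, ‖F b x‖ ^ (2 * n) ∂μ = ∫ x, ‖F a x‖ ^ (2 * n) ∂μ := by
    apply Complex.ofReal_injective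
    rw [← integral_npowL_star_mul (hF.mem_LInfty hb), ← integral_npowL_star_mul (hF.mem_LInfty ha)]
    rcases le_total a b with hab | hab
    · exact hsol.integral_eq hT hab (hS.out ha hb)
    · exact (hsol.integral_eq hT hab (hS.out hb ha)).symm
  rw [heq]
  have : ∫ x, ‖F a x‖ ^ (2 * n) ∂μ ≤ ∫ _, C ^ (2 * n) ∂μ := by
    refine integral_mono_of_nonneg (Eventually.of_forall fun x => by positivity)
      (integrable_const _) ?_
    filter_upwards [hC] with x hx
    gcongr
  simpa using this

/-- Orbits of bounded functions are locally bounded in `L^∞` at positive times. -/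
theorem eventually_bddBy_op (hinv : ∀ t : ℝ≥0, ∀ f ∈ LInfty μ, T.op t f ∈ LInfty μ)
    {f : Lp ℂ 1 μ} (hf : f ∈ LInfty μ) {r : ℝ≥0} (hr : 0 < r) :
    ∃ C, ∀ᶠ s in 𝓝 r, BddBy C (T.op s f) := by
  -- Baire applied to the times at which T(s) has L^∞-norm at most n. The bound is uniform over all
  -- functions because it is applied below to T(r - s₀)f.
  let K : ℕ → Set ℝ≥0 := fun n => {s | ∀ (C : ℝ) (f : Lp ℂ 1 μ), 0 ≤ C → BddBy C f →
    BddBy (n * C) (T.op s f)}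
  have hK : ∀ n, IsClosed (K n) := fun n => by
    simp only [K, Set.ofPred_forall]
    refine isClosed_iInter fun C => isClosed_iInter fun f => isClosed_iInter fun _ =>
      isClosed_iInter fun _ => ?_
    exact (isClosed_BddBy (n * C)).preimage (T.continuous_orbit f)
  have hU : ⋃ n, K n = Set.univ := by
    refine Set.eq_univ_of_forall fun s => Set.mem_iUnion.2 ?_
    obtain ⟨M, -, hM⟩ := exists_bound_of_invariant (T.op s) (hinv s)
    obtain ⟨n, hn⟩ := exists_nat_ge M
    exact ⟨n, fun C f hC hf => (hM C f hC hf).mono (by gcongr)⟩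
  -- Some s₀ in (0, r) is interior to some K n. For s near r, T(s)f is T(s - (r - s₀)) applied to
  -- T(r - s₀)f, with s - (r - s₀) near s₀.
  obtain ⟨s₀, hs₀, hs₀'⟩ := (dense_iUnion_interior_of_closed hK hU).exists_mem_open
    (isOpen_Ioo (a := 0) (b := r)) (Set.nonempty_Ioo.2 hr)
  obtain ⟨n, hn⟩ := Set.mem_iUnion.1 hs₀
  obtain ⟨C, hC⟩ := mem_LInfty_iff.1 (hinv (r - s₀) f hf)
  have hsub : Tendsto (fun s => s - (r - s₀)) (𝓝 r) (𝓝 s₀) := by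
    have : Continuous fun s : ℝ≥0 => s - (r - s₀) := by fun_prop
    have h := this.tendsto r
    rwa [tsub_tsub_cancel_of_le hs₀'.2.le] at h
  refine ⟨n * C, ?_⟩
  filter_upwards [hsub.eventually (mem_interior_iff_mem_nhds.1 hn),
    Ioi_mem_nhds (tsub_lt_self hr hs₀'.1)] with s hs hs'
  have := hs C _ hC.nonneg hC
  rwa [← T.op_add_apply, tsub_add_cancel_of_le (le_of_lt hs')] at this

theorem boundedSolution_orbit (hT : IsBoundedDerivation T)
    (hinv : ∀ t : ℝ≥0, ∀ f ∈ LInfty μ, T.op t f ∈ LInfty μ) (h1 : T.HasGenerator (oneL μ) 0)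
    {f g : Lp ℂ 1 μ} (hf : f ∈ LInfty μ) (hg : T.HasGenerator f g) :
    BoundedSolution T Set.univ fun t => T.op t f := by
  -- The Baire argument says nothing at time 0, so the orbit is first a solution on (0, ∞) only.
  have hpos : BoundedSolution T (Set.Ioi 0) fun t => T.op t f :=
    ⟨fun r _ => (T.continuous_orbit f).continuousAt, fun r hr => eventually_bddBy_op hinv hf hr,
      fun r _ => ⟨_, hg.op r, hg.hasRightDeriv r⟩⟩
  -- Any positive time serves as reference: conservation of moments spreads its bound over (0, ∞),
  -- and closedness in L¹ extends it to 0.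
  obtain ⟨C, hC⟩ := mem_LInfty_iff.1 (hinv 1 f hf)
  have hall : ∀ t > 0, BddBy C (T.op t f) := fun t ht =>
    hpos.bddBy_of_bddBy hT h1 (Set.mem_Ioi.2 zero_lt_one) ht hC
  have hzero : BddBy C (T.op 0 f) :=
    (isClosed_BddBy C).mem_of_tendsto
      (((T.continuous_orbit f).tendsto 0).mono_left (nhdsWithin_le_nhds (s := Set.Ioi 0)))
      (eventually_mem_nhdsWithin.mono hall)
  refine ⟨fun r _ => (T.continuous_orbit f).continuousAt, fun r _ => ⟨C, ?_⟩,
    fun r _ => ⟨_, hg.op r, hg.hasRightDeriv r⟩⟩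
  refine Eventually.of_forall fun s => ?_
  rcases eq_or_ne s 0 with rfl | hs
  · exact hzero
  · exact hall s (pos_iff_ne_zero.2 hs)

/-- A semigroup that is generated by a derivation is multiplicative. -/
theorem op_pmul_of_derivation (hT : IsBoundedDerivation T)
    (hinv : ∀ t : ℝ≥0, ∀ f ∈ LInfty μ, T.op t f ∈ LInfty μ) (h1 : T.HasGenerator (oneL μ) 0)
    (hd : Dense (boundedDomain T.generator : Set (Lp ℂ 1 μ))) (t : ℝ≥0) {f : Lp ℂ 1 μ}
    (hf : f ∈ LInfty μ) (g : Lp ℂ 1 μ) : T.op t (pmul f g) = pmul (T.op t f) (T.op t g) := by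
  have hBB : ∀ f ∈ boundedDomain T.generator, ∀ g ∈ boundedDomain T.generator,
      T.op t (pmul f g) = pmul (T.op t f) (T.op t g) := by
    rintro f ⟨⟨f', hf'⟩, hf⟩ g ⟨⟨g', hg'⟩, hg⟩
    have := ((boundedSolution_orbit hT hinv h1 hf hf').mul hT
      (boundedSolution_orbit hT hinv h1 hg hg')).eq_op t
    simpa [T.op_zero_apply] using this.symm
  -- Multiplication is L¹-continuous in one factor while the other is a fixed bounded function, so
  -- the factors are freed one at a time, with commutativity exchanging their roles.
  have hB : ∀ f ∈ boundedDomain T.generator, ∀ g : Lp ℂ 1 μ,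
      T.op t (pmul f g) = pmul (T.op t f) (T.op t g) := by
    intro f hf g
    refine isClosed_property (e := ((↑) : boundedDomain T.generator → Lp ℂ 1 μ)) hd.denseRange_val
      (isClosed_eq ((T.op t).continuous.comp (continuous_pmul hf.2))
        ((continuous_pmul (hinv t f hf.2)).comp (T.op t).continuous))
      (fun g => hBB f hf g g.2) g
  refine isClosed_property (e := ((↑) : boundedDomain T.generator → Lp ℂ 1 μ)) hd.denseRange_val
    (isClosed_eq ((T.op t).continuous.comp (continuous_pmul hf))
      ((continuous_pmul (hinv t f hf)).comp (T.op t).continuous))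
    (fun g => ?_) g
  change T.op t (pmul f g) = pmul (T.op t f) (T.op t g)
  rw [pmul_comm hf g.2.2, hB g g.2 f, pmul_comm (hinv t _ g.2.2) (hinv t f hf)]

/-- T1_M is idempotent because 1_M is, hence takes only the values 0 and 1; products of indicators
are intersections. -/
theorem exists_measureAlgHom_of_multiplicative (T : Lp ℂ 1 μ →L[ℂ] Lp ℂ 1 μ)
    (hinv : ∀ f ∈ LInfty μ, T f ∈ LInfty μ)
    (hmul : ∀ f ∈ LInfty μ, ∀ g, T (pmul f g) = pmul (T f) (T g))
    (hint : ∀ f : Lp ℂ 1 μ, ∫ x, T f x ∂μ = ∫ x, f x ∂μ) :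
    ∃ φ : MeasureAlgHom μ, ∀ M : MeasureAlg μ,
        T M.indicator = (φ.toLatticeHom M).indicator := by
  have hb := fun M : MeasureAlg μ => (MeasureAlg.bddBy_indicator M).mem_LInfty
  refine MeasureAlg.exists_measureAlgHom T (fun M => ?_) (fun M N M' N' hM hN => ?_) hint
  · refine MeasureAlg.exists_eq_indicator ?_
    have h := hmul _ (hb M) M.indicator
    rw [MeasureAlg.pmul_indicator, inf_idem] at h
    have h' := coeFn_pmul (hinv _ (hb M)) (T M.indicator)
    rw [← h] at h'
    filter_upwards [h'] with x hx
    rcases eq_or_ne (T M.indicator x) 0 with h0 | h0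
    · exact Or.inl h0
    · exact Or.inr ((mul_eq_left₀ h0).1 hx.symm)
  · rw [← MeasureAlg.pmul_indicator, hmul _ (hb M), hM, hN, MeasureAlg.pmul_indicator]

end Derivation

/-! ### Markov lattice operators and operators induced by measure algebra homomorphisms. -/

section Koopman

variable {X : Type*} [MeasurableSpace X] {μ : Measure X}

theorem coeFn_modulus (f : Lp ℂ 1 μ) : modulus f =ᵐ[μ] fun x => ((‖f x‖ : ℝ) : ℂ) :=
  MemLp.coeFn_toLp _

theorem continuous_modulus : Continuous (modulus : Lp ℂ 1 μ → Lp ℂ 1 μ) := by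
  refine continuous_iff_continuousAt.2 fun f => tendsto_iff_norm_sub_tendsto_zero.2 ?_
  refine squeeze_zero (fun _ => norm_nonneg _) (fun g => ?_)
    (tendsto_iff_norm_sub_tendsto_zero.1 (tendsto_id (x := 𝓝 f)))
  refine Lp.norm_le_norm_of_ae_le ?_
  filter_upwards [coeFn_modulus f, coeFn_modulus g, Lp.coeFn_sub (modulus g) (modulus f),
    Lp.coeFn_sub (id g) f] with x h1 h2 h3 h4
  rw [h3, h4, Pi.sub_apply, Pi.sub_apply, h1, h2, ← Complex.ofReal_sub, Complex.norm_real]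
  exact abs_norm_sub_norm_le _ _

variable [IsProbabilityMeasure μ]

namespace MeasureAlg

theorem indicator_univ : (mk μ Set.univ MeasurableSet.univ).indicator = oneL μ := by
  apply Lp.ext
  filter_upwards [coeFn_indicator_mk (μ := μ) MeasurableSet.univ, coeFn_oneL (μ := μ)] with x h1 h2
  rw [h1, h2]
  simp

/-- An element of full measure is the whole space. -/
theorem indicator_eq_one_of_measure_eq_one {M : MeasureAlg μ} (hM : M.measure = 1) :
    M.indicator = oneL μ := by
  induction M using MeasureAlg.ind with
  | h s hs =>
    have hs1 : ∀ᵐ x ∂μ, x ∈ s := (prob_compl_eq_zero_iff hs).2 hM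
    apply Lp.ext
    filter_upwards [coeFn_indicator_mk (μ := μ) hs, coeFn_oneL (μ := μ), hs1] with x h1 h2 h3
    rw [h1, h2]
    simp [h3]

/-- Expresses intersections through linear operations and the modulus alone, both of which a lattice
operator respects. -/
theorem two_smul_indicator_inf (M N : MeasureAlg μ) :
    (2 : ℂ) • (M ⊓ N).indicator
      = M.indicator + N.indicator - modulus (M.indicator - N.indicator) := by
  induction M using MeasureAlg.ind with
  | h s hs =>
    induction N using MeasureAlg.ind with
    | h t ht =>
      rw [mk_inf_mk]
      set f := (mk μ s hs).indicator
      set g := (mk μ t ht).indicator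
      apply Lp.ext
      filter_upwards [coeFn_indicator_mk (μ := μ) hs, coeFn_indicator_mk (μ := μ) ht,
        coeFn_indicator_mk (μ := μ) (hs.inter ht),
        Lp.coeFn_smul (2 : ℂ) (mk μ _ (hs.inter ht)).indicator,
        Lp.coeFn_sub (f + g) (modulus (f - g)), Lp.coeFn_add f g, Lp.coeFn_sub f g,
        coeFn_modulus (f - g)] with x h1 h2 h3 h4 h5 h6 h7 h8
      rw [h4, h5, Pi.smul_apply, h3, Pi.sub_apply, h6, Pi.add_apply, h8, h7, Pi.sub_apply, h1, h2]
      by_cases hxs : x ∈ s <;> by_cases hxt : x ∈ t <;> simp [hxs, hxt]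
      norm_num

/-- The modulus of `1_M - 1_{Mᶜ}` is `1`. -/
theorem modulus_two_smul_sub_one (M : MeasureAlg μ) :
    modulus ((2 : ℂ) • M.indicator - oneL μ) = oneL μ := by
  induction M using MeasureAlg.ind with
  | h s hs =>
    set f := (mk μ s hs).indicator
    apply Lp.ext
    filter_upwards [coeFn_indicator_mk (μ := μ) hs, coeFn_oneL (μ := μ),
      Lp.coeFn_smul (2 : ℂ) f, Lp.coeFn_sub ((2 : ℂ) • f) (oneL μ),
      coeFn_modulus ((2 : ℂ) • f - oneL μ)] with x h1 h2 h3 h4 h5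
    rw [h5, h4, Pi.sub_apply, h3, Pi.smul_apply, h1, h2]
    by_cases hxs : x ∈ s <;> simp [hxs]
    norm_num

end MeasureAlg

open scoped ComplexOrder in
/-- A Markov lattice operator is induced by a measure algebra homomorphism. -/
theorem IsMarkovLatticeOp.exists_measureAlgHom {T : Lp ℂ 1 μ →L[ℂ] Lp ℂ 1 μ}
    (hT : IsMarkovLatticeOp T) :
    ∃ φ : MeasureAlgHom μ, ∀ M : MeasureAlg μ,
        T M.indicator = (φ.toLatticeHom M).indicator := by
  refine MeasureAlg.exists_measureAlgHom T (fun M => ?_) (fun M N M' N' hM hN => ?_)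
    hT.integral_map
  · refine MeasureAlg.exists_eq_indicator ?_
    have h1 := hT.map_modulus ((2 : ℂ) • M.indicator - oneL μ)
    rw [MeasureAlg.modulus_two_smul_sub_one, hT.map_one, map_sub, map_smul, hT.map_one] at h1
    -- Positivity supplies the realness of T1_M: the equation |2z - 1| = 1 describes a circle in ℂ
    -- and leaves only 0 and 1 on the real line.
    have hpos : ∀ᵐ x ∂μ, 0 ≤ M.indicator x := by
      induction M using MeasureAlg.ind with
      | h s hs =>
        filter_upwards [MeasureAlg.coeFn_indicator_mk (μ := μ) hs] with x hx
        rw [hx]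
        by_cases hxs : x ∈ s <;> simp [hxs]
    have h2 := coeFn_modulus ((2 : ℂ) • T M.indicator - oneL μ)
    rw [h1] at h2
    filter_upwards [hT.positive _ hpos, h2, coeFn_oneL (μ := μ),
      Lp.coeFn_sub ((2 : ℂ) • T M.indicator) (oneL μ),
      Lp.coeFn_smul (2 : ℂ) (T M.indicator)] with x e1 e2 e3 e4 e5
    rw [e4, Pi.sub_apply, e5, Pi.smul_apply, e3] at e2
    obtain ⟨r, hr⟩ : ∃ r : ℝ, T M.indicator x = r := ⟨_, (Complex.eq_re_of_ofReal_le e1)⟩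
    rw [hr] at e2 ⊢
    have e6 : |2 * r - 1| = 1 := by
      have h3 : (2 : ℂ) • (r : ℂ) - 1 = ((2 * r - 1 : ℝ) : ℂ) := by simp
      rw [h3, Complex.norm_real] at e2
      exact_mod_cast e2.symm
    rcases eq_or_eq_neg_of_abs_eq e6 with h | h
    · right
      have : r = 1 := by linarith
      simp [this]
    · left
      have : r = 0 := by linarith
      simp [this]
  · have h1 := congrArg T (MeasureAlg.two_smul_indicator_inf M N)
    rw [map_smul, map_sub, map_add, ← hT.map_modulus, map_sub, hM, hN,
      ← MeasureAlg.two_smul_indicator_inf] at h1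
    exact smul_right_injective _ (two_ne_zero (α := ℂ)) h1

/-- Induction on elements of `L¹` from indicator functions. -/
theorem L1_induction {P : Lp ℂ 1 μ → Prop} (hind : ∀ M : MeasureAlg μ, P M.indicator)
    (hsmul : ∀ (c : ℂ) f, P f → P (c • f)) (hadd : ∀ f g, P f → P g → P (f + g))
    (hclosed : IsClosed {f | P f}) (f : Lp ℂ 1 μ) : P f := by
  induction f using Lp.induction ENNReal.one_ne_top with
  | indicatorConst c hs hμs =>
    rename_i s
    have h : ((Lp.simpleFunc.indicatorConst 1 hs hμs.ne c : Lp.simpleFunc ℂ 1 μ) : Lp ℂ 1 μ)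
        = c • (MeasureAlg.mk μ s hs).indicator := by
      rw [Lp.simpleFunc.coe_indicatorConst]
      apply Lp.ext
      filter_upwards [indicatorConstLp_coeFn (p := 1) (hs := hs) (hμs := hμs.ne) (c := c),
        MeasureAlg.coeFn_indicator_mk (μ := μ) hs,
        Lp.coeFn_smul c (MeasureAlg.mk μ s hs).indicator] with x h1 h2 h3
      rw [h1, h3, Pi.smul_apply, h2]
      by_cases hxs : x ∈ s <;> simp [hxs]
    rw [h]
    exact hsmul c _ (hind _)
  | add hf hg _ h1 h2 => exact hadd _ _ h1 h2
  | isClosed => exact hclosed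

variable (μ) in
/-- The class in `L¹` of a simple function. -/
def simpleL1 (s : SimpleFunc X ℂ) : Lp ℂ 1 μ := (s.memLp_of_isFiniteMeasure 1 μ).toLp s

theorem coeFn_simpleL1 (s : SimpleFunc X ℂ) : simpleL1 μ s =ᵐ[μ] s := MemLp.coeFn_toLp _

/-- In contrast to `L1_induction`, no additivity of P is required, so that it applies to the
modulus. -/
theorem simpleL1_induction {P : Lp ℂ 1 μ → Prop} (hs : ∀ s : SimpleFunc X ℂ, P (simpleL1 μ s))
    (hclosed : IsClosed {f | P f}) (f : Lp ℂ 1 μ) : P f := by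
  have hd := (Lp.simpleFunc.dense (E := ℂ) (μ := μ) ENNReal.one_ne_top)
  refine isClosed_property (e := ((↑) : Lp.simpleFunc ℂ 1 μ → Lp ℂ 1 μ)) hd.denseRange_val hclosed
    (fun g => ?_) f
  have : (g : Lp ℂ 1 μ) = simpleL1 μ (Lp.simpleFunc.toSimpleFunc g) := by
    apply Lp.ext
    filter_upwards [Lp.simpleFunc.toSimpleFunc_eq_toFun g,
      coeFn_simpleL1 (μ := μ) (Lp.simpleFunc.toSimpleFunc g)] with x h1 h2
    rw [h2, h1]
  rw [this]
  exact hs _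

theorem coeFn_sum_smul_indicator (R : Finset ℂ) (ψ : ℂ → ℂ) (N : ℂ → Set X)
    (hN : ∀ c, MeasurableSet (N c)) :
    ((∑ c ∈ R, ψ c • (MeasureAlg.mk μ (N c) (hN c)).indicator : Lp ℂ 1 μ) : X → ℂ)
      =ᵐ[μ] fun x => ∑ c ∈ R, ψ c * (N c).indicator (fun _ => (1 : ℂ)) x := by
  classical
  induction R using Finset.induction_on with
  | empty =>
    simp only [Finset.sum_empty]
    exact Lp.coeFn_zero _ _ _
  | insert a R ha ih =>
    simp only [Finset.sum_insert ha]
    filter_upwards [ih, Lp.coeFn_add (ψ a • (MeasureAlg.mk μ (N a) (hN a)).indicator)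
      (∑ c ∈ R, ψ c • (MeasureAlg.mk μ (N c) (hN c)).indicator),
      Lp.coeFn_smul (ψ a) (MeasureAlg.mk μ (N a) (hN a)).indicator,
      MeasureAlg.coeFn_indicator_mk (μ := μ) (hN a)] with x h1 h2 h3 h4
    rw [h2, Pi.add_apply, h1, h3, Pi.smul_apply, h4, smul_eq_mul]

/-- The decomposition uses the fibres of `s`, not those of `s.map ψ`, so the same sets serve every
ψ. -/
theorem simpleL1_map (s : SimpleFunc X ℂ) (ψ : ℂ → ℂ) :
    simpleL1 μ (s.map ψ) = ∑ c ∈ s.range,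
      ψ c • (MeasureAlg.mk μ (s ⁻¹' {c}) (s.measurableSet_fiber c)).indicator := by
  apply Lp.ext
  filter_upwards [coeFn_simpleL1 (μ := μ) (s.map ψ),
    coeFn_sum_smul_indicator (μ := μ) s.range ψ _ s.measurableSet_fiber] with x h1 h2
  rw [h1, h2, Finset.sum_eq_single (s x)]
  · simp
  · intro c _ hc
    simp [Set.indicator, hc.symm]
  · intro h
    exact absurd (s.mem_range_self x) h

/-- `T` is induced by a measure algebra homomorphism. -/
def IsKoopman (T : Lp ℂ 1 μ →L[ℂ] Lp ℂ 1 μ) : Prop :=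
  ∃ φ : MeasureAlgHom μ, ∀ M : MeasureAlg μ, T M.indicator = (φ.toLatticeHom M).indicator

namespace IsKoopman

variable {T : Lp ℂ 1 μ →L[ℂ] Lp ℂ 1 μ}

/-- A lattice homomorphism need not preserve the top element; here preservation of the measure
forces it. -/
theorem map_one (hT : IsKoopman T) : T (oneL μ) = oneL μ := by
  obtain ⟨φ, hφ⟩ := hT
  rw [← MeasureAlg.indicator_univ, hφ, MeasureAlg.indicator_univ]
  refine MeasureAlg.indicator_eq_one_of_measure_eq_one ((φ.measure_map _).trans ?_)
  exact measure_univ (μ := μ)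

/-- `T` commutes with pointwise functions of simple functions. -/
theorem map_simple (hT : IsKoopman T) (s : SimpleFunc X ℂ) (ψ : ℂ → ℂ) :
    T (simpleL1 μ (s.map ψ)) =ᵐ[μ] fun x => ψ (T (simpleL1 μ s) x) := by
  classical
  have hone := hT.map_one
  obtain ⟨φ, hφ⟩ := hT
  have hrep : ∀ M : MeasureAlg μ, ∃ (t : Set X) (ht : MeasurableSet t), M = MeasureAlg.mk μ t ht :=
    fun M => MeasureAlg.ind
      (p := fun M => ∃ (t : Set X) (ht : MeasurableSet t), M = MeasureAlg.mk μ t ht)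
      (fun t ht => ⟨t, ht, rfl⟩) M
  choose N hN hφN using fun c : ℂ =>
    hrep (φ.toLatticeHom (MeasureAlg.mk μ (s ⁻¹' {c}) (s.measurableSet_fiber c)))
  have hTs : ∀ χ : ℂ → ℂ, T (simpleL1 μ (s.map χ))
      =ᵐ[μ] fun x => ∑ c ∈ s.range, χ c * (N c).indicator (fun _ => (1 : ℂ)) x := by
    intro χ
    rw [simpleL1_map, map_sum]
    simp only [map_smul, hφ, hφN]
    exact coeFn_sum_smul_indicator _ _ _ _
  have h1 : simpleL1 μ (s.map fun _ => 1) = oneL μ := by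
    apply Lp.ext
    filter_upwards [coeFn_simpleL1 (μ := μ) (s.map fun _ => 1), coeFn_oneL (μ := μ)] with x e1 e2
    rw [e1, e2]
    simp
  have hsum := hTs fun _ => 1
  rw [h1, hone] at hsum
  have hid := hTs id
  rw [show s.map id = s from SimpleFunc.ext fun _ => rfl] at hid
  filter_upwards [hsum, hid, hTs ψ, coeFn_oneL (μ := μ)] with x e1 e2 e3 e4
  rw [e4] at e1
  have hchar : ∀ χ : ℂ → ℂ, ∑ c ∈ s.range, χ c * (N c).indicator (fun _ => (1 : ℂ)) x
      = ∑ c ∈ s.range with x ∈ N c, χ c := by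
    intro χ
    rw [Finset.sum_filter]
    refine Finset.sum_congr rfl fun c _ => ?_
    by_cases h : x ∈ N c <;> simp [h]
  rw [hchar] at e1 e2 e3
  -- The case ψ = 1 says T1 = 1, so almost every x lies in exactly one of the sets `N c`. Hence T s
  -- has the value c at x, and T (ψ ∘ s) the value ψ c.
  have hcard : (s.range.filter fun c => x ∈ N c).card = 1 := by
    simp only [Finset.sum_const, nsmul_eq_mul, mul_one] at e1
    exact_mod_cast e1.symm
  obtain ⟨c, hc⟩ := Finset.card_eq_one.1 hcard
  rw [hc, Finset.sum_singleton] at e2 e3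
  rw [e3, e2, id]

theorem map_modulus (hT : IsKoopman T) (f : Lp ℂ 1 μ) : modulus (T f) = T (modulus f) := by
  refine simpleL1_induction (P := fun f => modulus (T f) = T (modulus f)) (fun s => ?_)
    (isClosed_eq (continuous_modulus.comp T.continuous) (T.continuous.comp continuous_modulus)) f
  have h1 : modulus (simpleL1 μ s) = simpleL1 μ (s.map fun z => ((‖z‖ : ℝ) : ℂ)) := by
    apply Lp.ext
    filter_upwards [coeFn_modulus (simpleL1 μ s), coeFn_simpleL1 (μ := μ) s,
      coeFn_simpleL1 (μ := μ) (s.map fun z => ((‖z‖ : ℝ) : ℂ))] with x e1 e2 e3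
    rw [e1, e2, e3]
    simp
  rw [h1]
  apply Lp.ext
  filter_upwards [hT.map_simple s fun z => ((‖z‖ : ℝ) : ℂ), coeFn_modulus (T (simpleL1 μ s))]
    with x e1 e2
  rw [e1, e2]

theorem map_star (hT : IsKoopman T) (f : Lp ℂ 1 μ) : T (star f) = star (T f) := by
  refine simpleL1_induction (P := fun f => T (star f) = star (T f)) (fun s => ?_)
    (isClosed_eq (T.continuous.comp continuous_star_Lp) (continuous_star_Lp.comp T.continuous)) f
  have h1 : star (simpleL1 μ s) = simpleL1 μ (s.map star) := by
    apply Lp.ext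
    filter_upwards [Lp.coeFn_star (simpleL1 μ s), coeFn_simpleL1 (μ := μ) s,
      coeFn_simpleL1 (μ := μ) (s.map star)] with x e1 e2 e3
    rw [e1, Pi.star_apply, e2, e3]
    simp
  rw [h1]
  apply Lp.ext
  filter_upwards [hT.map_simple s star, Lp.coeFn_star (T (simpleL1 μ s))] with x e1 e2
  rw [e1, e2, Pi.star_apply]

theorem integral_map (hT : IsKoopman T) (f : Lp ℂ 1 μ) : ∫ x, T f x ∂μ = ∫ x, f x ∂μ := by
  refine L1_induction (P := fun f => integralL1 μ (T f) = integralL1 μ f) (fun M => ?_)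
    (fun c f hf => ?_) (fun f g hf hg => ?_)
    (isClosed_eq ((integralL1 μ).continuous.comp T.continuous) (integralL1 μ).continuous) f
  · obtain ⟨φ, hφ⟩ := hT
    have h : (φ.toLatticeHom M).measure = M.measure := φ.measure_map M
    rw [hφ, integralL1_apply, integralL1_apply, MeasureAlg.integral_indicator,
      MeasureAlg.integral_indicator, h]
  · rw [map_smul, map_smul, map_smul, hf]
  · rw [map_add, map_add, map_add, hf, hg]

open scoped ComplexOrder in
theorem isMarkovLatticeOp (hT : IsKoopman T) : IsMarkovLatticeOp T where
  positive f hf := by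
    have h : modulus f = f := by
      apply Lp.ext
      filter_upwards [coeFn_modulus f, hf] with x h1 h2
      rw [h1, Complex.norm_of_nonneg' h2]
    filter_upwards [coeFn_modulus (T f)] with x h1
    rw [hT.map_modulus, h] at h1
    rw [h1]
    exact_mod_cast norm_nonneg _
  map_modulus := hT.map_modulus
  map_one := hT.map_one
  integral_map := hT.integral_map

open scoped ComplexOrder in
-- Apply positivity to C·1 - |f|. The constant does not grow with T, so a bound on f holds along the
-- whole orbit.
theorem bddBy (hT : IsKoopman T) {C : ℝ} {f : Lp ℂ 1 μ} (hf : BddBy C f) : BddBy C (T f) := by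
  have h1 : ∀ᵐ x ∂μ, 0 ≤ ((C : ℂ) • oneL μ - modulus f) x := by
    filter_upwards [hf, Lp.coeFn_sub ((C : ℂ) • oneL μ) (modulus f), coeFn_modulus f,
      Lp.coeFn_smul (C : ℂ) (oneL μ), coeFn_oneL (μ := μ)] with x e1 e2 e3 e4 e5
    rw [e2, Pi.sub_apply, e4, e3, Pi.smul_apply, e5, smul_eq_mul, mul_one, sub_nonneg]
    exact_mod_cast e1
  have h2 := hT.isMarkovLatticeOp.positive _ h1
  rw [map_sub, map_smul, hT.map_one, ← hT.map_modulus] at h2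
  filter_upwards [h2, Lp.coeFn_sub ((C : ℂ) • oneL μ) (modulus (T f)), coeFn_modulus (T f),
      Lp.coeFn_smul (C : ℂ) (oneL μ), coeFn_oneL (μ := μ)] with x e1 e2 e3 e4 e5
  rw [e2, Pi.sub_apply, e4, e3, Pi.smul_apply, e5, smul_eq_mul, mul_one, sub_nonneg] at e1
  exact_mod_cast e1

theorem mem_LInfty (hT : IsKoopman T) {f : Lp ℂ 1 μ} (hf : f ∈ LInfty μ) : T f ∈ LInfty μ := by
  obtain ⟨C, hC⟩ := mem_LInfty_iff.1 hf
  exact (hT.bddBy hC).mem_LInfty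

theorem map_pmul_of_indicator {f : Lp ℂ 1 μ} (hf : f ∈ LInfty μ) (hTf : T f ∈ LInfty μ)
    (h : ∀ M : MeasureAlg μ, T (pmul f M.indicator) = pmul (T f) (T M.indicator))
    (g : Lp ℂ 1 μ) : T (pmul f g) = pmul (T f) (T g) := by
  refine L1_induction (P := fun g => T (pmul f g) = pmul (T f) (T g)) h
    (fun c g hg => ?_) (fun g₁ g₂ h₁ h₂ => ?_)
    (isClosed_eq (T.continuous.comp (continuous_pmul hf))
      ((continuous_pmul hTf).comp T.continuous)) g
  · rw [pmul_smul hf, map_smul, map_smul, pmul_smul hTf, hg]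
  · rw [pmul_add hf, map_add, map_add, pmul_add hTf, h₁, h₂]

/-- Both sides are linear and continuous in each factor with the other fixed and bounded. Reducing
one factor and then the other to indicators leaves preservation of intersections. -/
theorem map_pmul (hT : IsKoopman T) {f : Lp ℂ 1 μ} (hf : f ∈ LInfty μ) (g : Lp ℂ 1 μ) :
    T (pmul f g) = pmul (T f) (T g) := by
  have hb := fun M : MeasureAlg μ => (MeasureAlg.bddBy_indicator M).mem_LInfty
  refine map_pmul_of_indicator hf (hT.mem_LInfty hf) (fun M => ?_) g
  rw [pmul_comm hf (hb M), pmul_comm (hT.mem_LInfty hf) (hT.mem_LInfty (hb M))]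
  refine map_pmul_of_indicator (hb M) (hT.mem_LInfty (hb M)) (fun N => ?_) f
  obtain ⟨φ, hφ⟩ := hT
  rw [MeasureAlg.pmul_indicator, hφ, hφ, hφ, MeasureAlg.pmul_indicator]
  exact congrArg _ (φ.map_inf' M N)

end IsKoopman

variable {T : C0Semigroup (Lp ℂ 1 μ)}

/-- Each rule is the derivative at t = 0 of the corresponding invariance of T(t): multiplicativity,
commutation with conjugation, preservation of the integral. -/
theorem isBoundedDerivation_of_isKoopman (hT : ∀ t, IsKoopman (T.op t)) :
    IsBoundedDerivation T where
  mul {f g f' g'} hf hg hf' hg' := by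
    obtain ⟨C, hC⟩ := mem_LInfty_iff.1 hf
    have h := hasRightDeriv_pmul (T.continuous_orbit f).continuousAt
      (Eventually.of_forall fun s => (hT s).bddBy hC) ((hT 0).mem_LInfty hg)
      (C0Semigroup.hasGenerator_iff.1 hf') (C0Semigroup.hasGenerator_iff.1 hg')
    simp only [T.op_zero_apply] at h
    rw [C0Semigroup.hasGenerator_iff]
    simpa only [(hT _).map_pmul hf] using h
  star {f f'} _ hf' := by
    refine ((continuous_star_Lp.tendsto _).comp hf').congr fun h => ?_
    simp only [Function.comp, star_smul_Lp, star_sub_Lp, (hT h).map_star]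
    simp
  integral_eq_zero {f f'} hf' := by
    have h := ((integralL1 μ).continuous.tendsto _).comp hf'
    refine tendsto_nhds_unique h (tendsto_const_nhds.congr fun t => ?_)
    simp only [Function.comp, map_smul, map_sub, integralL1_apply, (hT t).integral_map, sub_self,
      smul_zero]

theorem isBoundedDerivation_of_isDerivationOnBounded (hA : IsDerivationOnBounded T.generator)
    (h0 : AdjointAnnihilates T.generator) : IsBoundedDerivation T where
  mul {f g f' g'} hf hg hf' hg' := by
    obtain ⟨h, he⟩ := hA.leibniz f g ⟨hf'.mem_domain, hf⟩ ⟨hg'.mem_domain, hg⟩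
    have hgen := T.hasGenerator_generator ⟨_, h⟩
    rw [he, C0Semigroup.generator_eq hf', C0Semigroup.generator_eq hg'] at hgen
    rw [pmul_eq_bmul hf, pmul_eq_bmul hf, pmul_eq_bmul hg]
    exact hgen
  star {f f'} hf hf' := by
    obtain ⟨h, he⟩ := hA.map_star f ⟨hf'.mem_domain, hf⟩
    have hgen := T.hasGenerator_generator ⟨_, h⟩
    rwa [he, C0Semigroup.generator_eq hf'] at hgen
  integral_eq_zero {f f'} hf' := by
    have := h0 ⟨f, hf'.mem_domain⟩
    rwa [C0Semigroup.generator_eq hf'] at this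

theorem IsBoundedDerivation.isDerivationOnBounded (hT : IsBoundedDerivation T)
    (h1 : T.HasGenerator (oneL μ) 0) :
    IsBoundedAlgebra (boundedDomain T.generator) ∧ IsDerivationOnBounded T.generator ∧
      AdjointAnnihilates T.generator := by
  have halg : IsBoundedAlgebra (boundedDomain T.generator) := by
    refine ⟨inf_le_right, ?_⟩
    rintro ⟨f, ⟨f', hf'⟩, hf⟩ ⟨g, ⟨g', hg'⟩, hg⟩
    have h := (hT.mul hf hg hf' hg').mem_domain
    have h' := pmul_mem hf hg
    rw [pmul_eq_bmul hf] at h h'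
    exact ⟨h, h'⟩
  refine ⟨halg, ⟨halg, ⟨h1.mem_domain, bddBy_oneL.mem_LInfty⟩, ?_, ?_⟩, ?_⟩
  · rintro f g ⟨⟨f', hf'⟩, hf⟩ ⟨⟨g', hg'⟩, hg⟩
    have h := hT.mul hf hg hf' hg'
    rw [pmul_eq_bmul hf, pmul_eq_bmul hf, pmul_eq_bmul hg] at h
    refine ⟨h.mem_domain, ?_⟩
    rw [C0Semigroup.generator_eq h, C0Semigroup.generator_eq hf', C0Semigroup.generator_eq hg']
  · rintro f ⟨⟨f', hf'⟩, hf⟩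
    have h := hT.star hf hf'
    exact ⟨h.mem_domain, by rw [C0Semigroup.generator_eq h, C0Semigroup.generator_eq hf']⟩
  · exact fun f => hT.integral_eq_zero (T.hasGenerator_generator f)

/-- The L^∞-ball of radius C is convex, closed in L¹ and invariant, so averaging the orbit of a
bounded function approximates it within D(A) ∩ L^∞. -/
theorem dense_boundedDomain_of_isKoopman (hT : ∀ t, IsKoopman (T.op t)) :
    Dense (boundedDomain T.generator : Set (Lp ℂ 1 μ)) := by
  refine dense_closure.1 ((dense_LInfty (μ := μ)).mono fun f hf => ?_)
  obtain ⟨C, hC⟩ := mem_LInfty_iff.1 (show f ∈ LInfty μ from hf)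
  exact closure_mono
    (show (T.generator.domain : Set (Lp ℂ 1 μ)) ∩ {g | BddBy C g} ⊆ boundedDomain T.generator from
      fun g hg => ⟨hg.1, BddBy.mem_LInfty hg.2⟩)
    (T.mem_closure_domain_inter (K := {g | BddBy C g})
      (fun g hg h hh a b ha hb hab => hg.convex_comb hh ha hb hab) (isClosed_BddBy C)
      fun t => (hT t).bddBy hC)

end Koopman

end

theorem theorem2p1 {X : Type*} [MeasurableSpace X] (μ : Measure X) [IsProbabilityMeasure μ]
    (T : C0Semigroup (Lp ℂ 1 μ)) :
    List.TFAE [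
      ∀ t : ℝ≥0, IsMarkovLatticeOp (T.op t),
      ∀ t : ℝ≥0, ∃ φ : MeasureAlgHom μ, ∀ M : MeasureAlg μ,
        T.op t M.indicator = (φ.toLatticeHom M).indicator,
      (∀ t : ℝ≥0, ∀ f ∈ LInfty μ, T.op t f ∈ LInfty μ) ∧
        IsBoundedAlgebra (boundedDomain T.generator) ∧
        Dense (boundedDomain T.generator : Set (Lp ℂ 1 μ)) ∧
        IsDerivationOnBounded T.generator ∧
        AdjointAnnihilates T.generator] := by
  tfae_have 1 → 2 := fun h t => (h t).exists_measureAlgHom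
  tfae_have 2 → 1 := fun h t => IsKoopman.isMarkovLatticeOp (h t)
  tfae_have 2 → 3 := fun h => by
    have hT : ∀ t, IsKoopman (T.op t) := h
    have h1 : T.HasGenerator (oneL μ) 0 := by
      simp [C0Semigroup.HasGenerator, (hT _).map_one]
    obtain ⟨halg, hder, hadj⟩ :=
      (isBoundedDerivation_of_isKoopman hT).isDerivationOnBounded h1
    exact ⟨fun t f hf => (hT t).mem_LInfty hf, halg, dense_boundedDomain_of_isKoopman hT, hder,
      hadj⟩
  tfae_have 3 → 2 := by
    rintro ⟨hinv, -, hd, hder, hadj⟩ t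
    have hT := isBoundedDerivation_of_isDerivationOnBounded hder hadj
    have h1 := hT.hasGenerator_one hder.one_mem.1
    exact exists_measureAlgHom_of_multiplicative (T.op t) (hinv t)
      (fun f hf g => op_pmul_of_derivation hT hinv h1 hd t hf g)
      (integral_op_of_derivation hT (hd.mono fun f hf => hf.1) t)
  tfae_finish
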